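/- Let $m \geq 0$ be an integer and let $\alpha$ be a linear endomorphism of $\mathbf R^{m}$ all of whose complex eigenvalues have real part $1$. Let $S = \mathbf R^{m} \rtimes_\alpha \mathbf R$ be the Lie group with underlying manifold $\mathbf R^{m} \times \mathbf R$ and group law $(v,t)(w,s) = (v + e^{t\alpha} w,\, t+s)$. Then $S$ has left-invariant Riemannian metrics with pinching arbitrarily close to $-1$: for every real $b > 1$ there is a smooth left-invariant Riemannian metric $g$ on $S$, all of whose sectional curvatures satisfy $-b^2 \leq \sec_g \leq -1$. Moreover, if $K$ is a compact group of automorphisms of the Lie group $S$ (a subgroup of the group of continuous automorphisms of $S$ which is compact in the compact-open topology), then for every real $b > 1$ there is such a metric $g$ which is in addition $K$-invariant, that is, $\varphi^* g = g$ for every $\varphi \in K$. -/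

import Mathlib

open scoped ContDiff Manifold TensorProduct

noncomputable section

section RiemannianGeometry

variable (E : Type*) [NormedAddCommGroup E] [NormedSpace ℝ E]

/-- A smooth Riemannian metric on the manifold underlying a real normed space `E`. -/
abbrev SmoothMetric : Type _ :=
  Bundle.ContMDiffRiemannianMetric 𝓘(ℝ, E) ∞ E (fun x : E => TangentSpace 𝓘(ℝ, E) x)

variable {E}

namespace SmoothMetric

/-- The metric in the global chart: a bilinear form on `E` for every point of `E`. -/
def form (g : SmoothMetric E) (x : E) : E →L[ℝ] E →L[ℝ] ℝ := g.inner x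

/-- The Christoffel symbols of the Levi-Civita connection in the global chart: `Γ_x(u, v)` is the
covariant derivative `∇_u v` at `x` of constant vector fields, that is, the vector with
`2 g_x(Γ_x(u, v), w) = (∂_u g)(v, w) + (∂_v g)(u, w) - (∂_w g)(u, v)` for all `w`.
The inverse is that of `u ↦ g_x(u, ·)`, an isomorphism onto the dual when `E` is
finite-dimensional. -/
def christoffel (g : SmoothMetric E) (x u v : E) : E :=
  (g.form x).inverse ((1 / 2 : ℝ) •
    (fderiv ℝ g.form x u v + fderiv ℝ g.form x v u - ((fderiv ℝ g.form x).flip u).flip v))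

/-- The Riemann curvature `R(u, v) w = ∇_u ∇_v w - ∇_v ∇_u w - ∇_[u, v] w` at `x`, computed
with constant vector fields (so that `[u, v] = 0`). -/
def curvature (g : SmoothMetric E) (x u v w : E) : E :=
  fderiv ℝ (fun y => g.christoffel y v w) x u - fderiv ℝ (fun y => g.christoffel y u w) x v
    + g.christoffel x u (g.christoffel x v w) - g.christoffel x v (g.christoffel x u w)

/-- The sectional curvature at `x` of the plane spanned by linearly independent `u` and `v`. -/
def sec (g : SmoothMetric E) (x u v : E) : ℝ :=
  g.form x (g.curvature x u v v) u /
    (g.form x u u * g.form x v v - g.form x u v ^ 2)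

/-- `g` is (normalized and) `-1 / b ^ 2`-pinched: all sectional curvatures lie in `[-b ^ 2, -1]`. -/
def IsPinched (g : SmoothMetric E) (b : ℝ) : Prop :=
  ∀ x u v : E, LinearIndependent ℝ ![u, v] → -b ^ 2 ≤ g.sec x u v ∧ g.sec x u v ≤ -1

/-- The smooth map `φ` preserves the metric `g`, i.e. `φ^* g = g`. -/
def IsInvariantUnder (g : SmoothMetric E) (φ : E → E) : Prop :=
  ContDiff ℝ ∞ φ ∧ ∀ x u v : E, g.form (φ x) (fderiv ℝ φ x u) (fderiv ℝ φ x v) = g.form x u v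

end SmoothMetric

end RiemannianGeometry

section Group

variable {V : Type*} [NormedAddCommGroup V] [NormedSpace ℝ V]

/-- The underlying set of the semidirect product of `V` and `ℝ` in which `t : ℝ` acts on `V`
by `exp (t α)`. As a smooth manifold it is the vector space `V × ℝ`. -/
def SemidirectLine (_α : V →L[ℝ] V) : Type _ := V × ℝ

namespace SemidirectLine

variable {α : V →L[ℝ] V}

instance : NormedAddCommGroup (SemidirectLine α) := inferInstanceAs (NormedAddCommGroup (V × ℝ))

instance : NormedSpace ℝ (SemidirectLine α) := inferInstanceAs (NormedSpace ℝ (V × ℝ))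

instance [FiniteDimensional ℝ V] : FiniteDimensional ℝ (SemidirectLine α) :=
  inferInstanceAs (FiniteDimensional ℝ (V × ℝ))

/-- The one-parameter group `t ↦ exp (t α)`. -/
def flow (α : V →L[ℝ] V) (t : ℝ) : V →L[ℝ] V := NormedSpace.exp (t • α)

theorem flow_zero (α : V →L[ℝ] V) : flow α 0 = 1 := by
  simp [flow]

theorem flow_add [CompleteSpace V] (α : V →L[ℝ] V) (s t : ℝ) :
    flow α (s + t) = flow α s * flow α t := by
  have h : Commute (s • α) (t • α) := ((Commute.refl α).smul_left s).smul_right t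
  let _ : NormedAlgebra ℚ (V →L[ℝ] V) := NormedAlgebra.restrictScalars ℚ ℝ (V →L[ℝ] V)
  rw [flow, flow, flow, add_smul, NormedSpace.exp_add_of_commute h]

/-- The group law `(v, t) (w, s) = (v + exp (t α) w, t + s)`. -/
instance [CompleteSpace V] : Group (SemidirectLine α) where
  mul p q := ((p.1 + flow α p.2 q.1, p.2 + q.2) : V × ℝ)
  one := ((0, 0) : V × ℝ)
  inv p := ((-flow α (-p.2) p.1, -p.2) : V × ℝ)
  mul_assoc p q r := by
    refine Prod.ext ?_ (add_assoc p.2 q.2 r.2)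
    change (p.1 + flow α p.2 q.1) + flow α (p.2 + q.2) r.1
      = p.1 + flow α p.2 (q.1 + flow α q.2 r.1)
    rw [flow_add, map_add, add_assoc]
    rfl
  one_mul p := by
    refine Prod.ext ?_ (zero_add p.2)
    change 0 + flow α 0 p.1 = p.1
    rw [flow_zero, zero_add]
    rfl
  mul_one p := by
    refine Prod.ext ?_ (add_zero p.2)
    change p.1 + flow α p.2 0 = p.1
    rw [map_zero, add_zero]
  inv_mul_cancel p := by
    refine Prod.ext ?_ (neg_add_cancel p.2)
    change -flow α (-p.2) p.1 + flow α (-p.2) p.1 = 0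
    exact neg_add_cancel _

end SemidirectLine

/-- The Riemannian metric `g` is invariant under all left translations. -/
def IsLeftInvariantMetric [CompleteSpace V] {α : V →L[ℝ] V}
    (g : SmoothMetric (SemidirectLine α)) : Prop :=
  ∀ p : SemidirectLine α, g.IsInvariantUnder (fun x => p * x)

/-- `K` is a compact group of automorphisms of the Lie group: it consists of continuous (hence
smooth) automorphisms, and it is compact in the compact-open topology, the usual topology of the
automorphism group of a Lie group. -/
def IsCompactAutGroup [CompleteSpace V] {α : V →L[ℝ] V}
    (K : Subgroup (MulAut (SemidirectLine α))) : Prop :=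
  (∀ φ ∈ K, Continuous φ) ∧
    IsCompact {f : C(SemidirectLine α, SemidirectLine α) | ∃ φ ∈ K, ∀ x, f x = φ x}

end Group

end

/-!
Write `h_t = h (exp (-tα) ·, exp (-tα) ·)` for an inner product `h` on `V = ℝ^m`. The metric
`h_t + dt²` on `V × ℝ` is left-invariant, and its curvature is computable: the slices `V × {t}` are
flat with second fundamental form the `h`-symmetric part `D` of `α`, and the Codazzi equation shows
that the curvature operator splits. For tangent vectors `u = (x, s)` and `v = (y, r)` at the
identity,

`⟨R(u, v) v, u⟩ = -(h(Dx, x) h(Dy, y) - h(Dx, y)²) - (h(αz, αz) + h(α²z, z) - h(Dz, Dz))`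

with `z = r x - s y` (`SemidirectLine.sumForm_frameCurvature`). If `D` were the identity, this would
be `-1` times the Gram determinant of `u` and `v`. So it is enough to find an `h` with
`h(αx, x)` close to `h(x, x)` and `h(αx, αx) + h(α²x, x)` close to `2 h(x, x)`
(`IsAdaptedInner`); multiplying the metric by a constant close to `1` then gives the exact bounds
(`SemidirectLine.isPinched_metric`).

Such an `h` comes from the Jordan–Chevalley decomposition of the complexification of `α`. Its
semisimple part is the identity plus a skew operator for the Hermitian form of an eigenbasis. Adding
up the pull-backs of this form under the powers of `c n`, where `n` is the nilpotent part and `c` a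
large constant, keeps the semisimple part skew and gives `n` norm at most `1 / c`
(`exists_isAdaptedInner`).

As for the compact group `K`: since `1` is the only real part of an eigenvalue, every automorphism
acts trivially on the quotient `ℝ`, and the cocycle describing it on the factor `ℝ` is a coboundary,
because `exp α - 1` is invertible. So automorphisms are of the form
`(v, t) ↦ (A v + exp (tα) w - w, t)` with `A` commuting with `α`
(`SemidirectLine.exists_eq_affineAut`). The conditions on `h` are convex and invariant under such
`A`, so that averaging over the compact group of derivatives at the identity makes `h` invariant.
Averaging the vector `(0, 1)` gives an invariant vector `(ξ, 1)`
(`SemidirectLine.exists_invariant_isAdaptedInner`), which is declared to be the unit normal of `V`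
at the identity; the curvature computation is carried out for such metrics. For `V = 0` the group is
the line, and a compact group of its automorphisms is contained in `{1, -1}`.

The curvature of the chart is computed in a moving frame depending linearly on the tangent vector
(`IsLinearFrame`), in which Christoffel symbols and curvature are constant.
-/

noncomputable section

/-! ### Inner products adapted to an endomorphism -/

/-- An inner product `h` for which the endomorphism `α` is, up to an error `ε`, the identity plus a
skew-symmetric operator. In terms of the inner products `h_t = h (exp (tα) ·, exp (tα) ·)` the two
estimates say that `∂_t h_t` is close to `2 h_t` and `∂_t² h_t` is close to `4 h_t`. Both are linear
inequalities in `h`, so that they survive averaging over a group commuting with `α`. -/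
structure IsAdaptedInner {V : Type*} [NormedAddCommGroup V] [NormedSpace ℝ V]
    (α : V →L[ℝ] V) (ε : ℝ) (h : V →L[ℝ] V →L[ℝ] ℝ) : Prop where
  symm : ∀ x y, h x y = h y x
  pos : ∀ x, x ≠ 0 → 0 < h x x
  first : ∀ x, |h (α x) x - h x x| ≤ ε * h x x
  second : ∀ x, |h (α x) (α x) + h (α (α x)) x - 2 * h x x| ≤ ε * h x x

/-- The Jordan–Chevalley decomposition of a complex endomorphism, with an eigenbasis of its
semisimple part. -/
theorem Module.End.exists_eigenbasis_add_nilpotent {W : Type*} [AddCommGroup W] [Module ℂ W]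
    [FiniteDimensional ℂ W] (f : Module.End ℂ W) :
    ∃ (n s : Module.End ℂ W) (I : Type) (_ : Fintype I) (b : Module.Basis I ℂ W) (μ : I → ℂ),
      Commute n s ∧ IsNilpotent n ∧ f = n + s ∧ (∀ i, s (b i) = μ i • b i) ∧
        ∀ i, μ i ∈ spectrum ℂ f := by
  classical
  obtain ⟨n, hn_adj, s, hns, hn, hs, hf⟩ := f.exists_isNilpotent_isSemisimple
  replace hns : Commute n s :=
    Algebra.commute_of_mem_adjoin_singleton_of_commute hns
      (Algebra.commute_of_mem_adjoin_self hn_adj).symm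
  let D := DirectSum.isInternal_submodule_of_iSupIndep_of_iSup_eq_top
    s.eigenspaces_iSupIndep hs.iSup_eigenspace_eq_top
  let v := D.collectedBasis fun μ ↦ Module.finBasis ℂ (s.eigenspace μ)
  have : Fintype ((ν : ℂ) × Fin (Module.finrank ℂ (s.eigenspace ν))) :=
    FiniteDimensional.fintypeBasisIndex v
  have hsv i : s (v i) = i.1 • v i :=
    Module.End.mem_eigenspace_iff.mp (D.collectedBasis_mem _ i)
  refine ⟨n, s, _, this, v, Sigma.fst, hns, hn, hf, hsv, fun i => ?_⟩
  have hi : i.1 ∈ spectrum ℂ s :=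
    (Module.End.hasEigenvalue_of_hasEigenvector
      ⟨Module.End.mem_eigenspace_iff.mpr (hsv i), v.ne_zero i⟩).mem_spectrum
  rw [spectrum.mem_iff] at hi ⊢
  intro hu
  apply hi
  -- a nilpotent perturbation commuting with an invertible operator keeps it invertible
  have e : algebraMap ℂ (Module.End ℂ W) i.1 - s = (algebraMap ℂ (Module.End ℂ W) i.1 - f) + n := by
    rw [hf]; abel
  rw [e]
  refine hn.isUnit_add_left_of_commute hu ?_
  rw [hf]
  exact ((Algebra.commute_algebraMap_right i.1 n).sub_right ((Commute.refl n).add_right hns))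

/-- A nilpotent operator commuting with a diagonalizable operator `s` can be made small, keeping
`s` diagonal in an orthogonal embedding: the coordinates of `x, c n x, c² n² x, …`. -/
theorem exists_embedding_small_nilpotent {W : Type*} [AddCommGroup W] [Module ℂ W]
    {n s : Module.End ℂ W} {I : Type} [Fintype I] (b : Module.Basis I ℂ W) {μ : I → ℂ}
    (hc : Commute n s) (hn : IsNilpotent n) (hs : ∀ i, s (b i) = μ i • b i)
    {η : ℝ} (hη : 0 < η) :
    ∃ (d : ℕ) (J : W →ₗ[ℂ] EuclideanSpace ℂ (Fin d × I)), Function.Injective J ∧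
      (∀ x, ‖J (n x)‖ ≤ η * ‖J x‖) ∧ ∀ x p, J (s x) p = μ p.2 * J x p := by
  obtain ⟨d, hd⟩ := hn
  have hrepr : ∀ x i, b.repr (s x) i = μ i * b.repr x i := by
    intro x i
    classical
    have : (b.coord i).comp s = μ i • b.coord i := b.ext fun j => by
      simp only [LinearMap.comp_apply, hs, map_smul, LinearMap.smul_apply, Module.Basis.coord_apply,
        Module.Basis.repr_self, Finsupp.single_apply, smul_eq_mul]
      split_ifs with h <;> simp [h]
    simpa using LinearMap.congr_fun this x
  let c : ℂ := (η⁻¹ : ℝ)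
  let J : W →ₗ[ℂ] EuclideanSpace ℂ (Fin (d + 1) × I) :=
    (WithLp.linearEquiv 2 ℂ (Fin (d + 1) × I → ℂ)).symm.toLinearMap ∘ₗ
      LinearMap.pi fun p => (c ^ (p.1 : ℕ)) • (b.coord p.2 ∘ₗ n ^ (p.1 : ℕ))
  have hJ : ∀ x p, J x p = c ^ (p.1 : ℕ) * b.repr ((n ^ (p.1 : ℕ)) x) p.2 := fun x p => rfl
  refine ⟨d + 1, J, ?_, fun x => ?_, fun x p => ?_⟩
  · rw [injective_iff_map_eq_zero]
    intro x hx
    apply b.repr.map_eq_zero_iff.1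
    ext i
    have := hJ x (0, i)
    rw [hx] at this
    simpa using this.symm
  · have hsq : ∀ y, ‖J y‖ ^ 2 =
        ∑ k ∈ Finset.range (d + 1), ∑ i, ‖c ^ k * b.repr ((n ^ k) y) i‖ ^ 2 := by
      intro y
      rw [EuclideanSpace.norm_sq_eq, Fintype.sum_prod_type,
        Finset.sum_range (fun k => ∑ i, ‖c ^ k * b.repr ((n ^ k) y) i‖ ^ 2)]
      rfl
    refine le_of_sq_le_sq ?_ (by positivity)
    rw [mul_pow, hsq, hsq, Finset.sum_range_succ, Finset.sum_range_succ', mul_add, Finset.mul_sum]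
    have hlast : ∑ i, ‖c ^ d * b.repr ((n ^ d) (n x)) i‖ ^ 2 = 0 := by simp [hd]
    rw [hlast]
    refine add_le_add (Finset.sum_le_sum fun k _ => ?_) (by positivity)
    rw [Finset.mul_sum]
    refine Finset.sum_le_sum fun i _ => ?_
    have e : (n ^ k) (n x) = (n ^ (k + 1)) x := by rw [pow_succ]; rfl
    have hcn : ‖c‖ = η⁻¹ := by simp [c, abs_of_pos hη]
    rw [e, norm_mul, norm_mul, norm_pow, norm_pow, hcn, pow_succ (η⁻¹), ← mul_pow]
    apply le_of_eq
    congr 1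
    field_simp
  · have e : (n ^ (p.1 : ℕ)) (s x) = s ((n ^ (p.1 : ℕ)) x) :=
      LinearMap.congr_fun (hc.pow_left (p.1 : ℕ)).eq x
    rw [hJ, hJ, e, hrepr]
    ring

/-- If every complex eigenvalue of `α` has real part `1`, then `α` is as close as desired to the
identity plus a skew-symmetric operator, for a suitable inner product. -/
theorem exists_isAdaptedInner {V : Type*} [NormedAddCommGroup V] [NormedSpace ℝ V]
    [FiniteDimensional ℝ V] (α : V →L[ℝ] V)
    (hα : spectrum ℂ (LinearMap.baseChange ℂ α.toLinearMap : Module.End ℂ (ℂ ⊗[ℝ] V)) ⊆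
      {z : ℂ | z.re = 1}) {ε : ℝ} (hε : 0 < ε) :
    ∃ h : V →L[ℝ] V →L[ℝ] ℝ, IsAdaptedInner α ε h := by
  obtain ⟨n, s, I, _, b, μ, hc, hn, hf, hs, hμ⟩ := Module.End.exists_eigenbasis_add_nilpotent
    (LinearMap.baseChange ℂ α.toLinearMap : Module.End ℂ (ℂ ⊗[ℝ] V))
  have hre : ∀ i, (μ i).re = 1 := fun i => hα (hμ i)
  -- a bound for the skew part of the semisimple part
  obtain ⟨M, hM0, hM⟩ : ∃ M : ℝ, 0 ≤ M ∧ ∀ i, ‖μ i - 1‖ ≤ M :=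
    ⟨∑ i, ‖μ i - 1‖, by positivity, fun i =>
      Finset.single_le_sum (f := fun i => ‖μ i - 1‖) (fun _ _ => norm_nonneg _) (Finset.mem_univ i)⟩
  obtain ⟨η, hη0, hη1, hηε⟩ : ∃ η : ℝ, 0 < η ∧ η ≤ 1 ∧ η * (4 + 2 * (M + 1)) ≤ ε := by
    refine ⟨min 1 (ε / (4 + 2 * (M + 1))), by positivity, min_le_left _ _, ?_⟩
    calc _ ≤ ε / (4 + 2 * (M + 1)) * (4 + 2 * (M + 1)) := by gcongr; exact min_le_right _ _
      _ = ε := by field_simp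
  obtain ⟨d, J, hJinj, hJn, hJs⟩ := exists_embedding_small_nilpotent b hc hn hs hη0
  let E' := EuclideanSpace ℂ (Fin d × I)
  let _ : InnerProductSpace ℝ E' := InnerProductSpace.rclikeToReal ℂ E'
  let ι : V →ₗ[ℝ] ℂ ⊗[ℝ] V := TensorProduct.mk ℝ ℂ V 1
  have hι : Function.Injective ι := by
    have h := (Module.Flat.rTensor_preserves_injective_linearMap (M := V)
      (Algebra.linearMap ℝ ℂ) Complex.ofReal_injective).comp (TensorProduct.lid ℝ V).symm.injective
    convert h using 1
    ext x
    simp [ι]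
  let T : V →L[ℝ] E' := LinearMap.toContinuousLinearMap ((J.restrictScalars ℝ).comp ι)
  let h : V →L[ℝ] V →L[ℝ] ℝ := (innerSL ℝ : E' →L[ℝ] E' →L[ℝ] ℝ).bilinearComp T T
  have hh : ∀ x y, h x y = inner ℝ (J (ι x)) (J (ι y)) := fun x y => rfl
  let N : Module.End ℂ (ℂ ⊗[ℝ] V) := n + (s - 1)
  have hια : ∀ x, J (ι (α x)) = J (ι x) + J (N (ι x)) := by
    intro x
    have : ι (α x) = (n + s) (ι x) := by rw [← hf]; simp [ι]
    rw [this, ← map_add]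
    congr 1
    simp [N]
    abel
  have hJ1 : ∀ x p, J ((s - 1) x) p = (μ p.2 - 1) * J x p := by
    intro x p
    have := hJs x p
    simp only [LinearMap.sub_apply, Module.End.one_apply, map_sub, PiLp.sub_apply, this]
    ring
  have hskew : ∀ x y, inner ℝ (J ((s - 1) x)) (J y) = - inner ℝ (J x) (J ((s - 1) y)) := by
    intro x y
    rw [real_inner_eq_re_inner ℂ, real_inner_eq_re_inner ℂ, PiLp.inner_apply, PiLp.inner_apply,
      map_sum, map_sum, ← Finset.sum_neg_distrib]
    refine Finset.sum_congr rfl fun p _ => ?_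
    simp only [hJ1]
    have := hre p.2
    simp [this]
    ring
  have hsn : ∀ x, ‖J ((s - 1) x)‖ ≤ M * ‖J x‖ := by
    intro x
    refine le_of_sq_le_sq ?_ (by positivity)
    rw [mul_pow, EuclideanSpace.norm_sq_eq, EuclideanSpace.norm_sq_eq, Finset.mul_sum]
    refine Finset.sum_le_sum fun p _ => ?_
    rw [hJ1, norm_mul, mul_pow]
    gcongr
    exact hM p.2
  have hNn : ∀ x, ‖J (N x)‖ ≤ (M + 1) * ‖J x‖ := by
    intro x
    have : J (N x) = J (n x) + J ((s - 1) x) := by rw [← map_add]; rfl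
    rw [this]
    refine (norm_add_le _ _).trans ?_
    have h1 := hJn x
    have h2 := hsn x
    have h3 : η * ‖J x‖ ≤ 1 * ‖J x‖ := by gcongr
    linarith
  -- `inner (N x) x` only sees the nilpotent part
  have hNx : ∀ x, inner ℝ (J (N x)) (J x) = inner ℝ (J (n x)) (J x) := by
    intro x
    have e : J (N x) = J (n x) + J ((s - 1) x) := by rw [← map_add]; rfl
    have := hskew x x
    rw [e, inner_add_left]
    have h2 := real_inner_comm (J x) (J ((s - 1) x))
    linarith
  have hest1 : ∀ x, |inner ℝ (J (n x)) (J x)| ≤ η * ‖J x‖ ^ 2 := by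
    intro x
    refine (abs_real_inner_le_norm _ _).trans ?_
    have := mul_le_mul_of_nonneg_right (hJn x) (norm_nonneg (J x))
    linarith [this]
  have hest2 : ∀ x, |inner ℝ (J (N x)) (J (N x)) + inner ℝ (J (N (N x))) (J x)| ≤
      η * (2 * (M + 1)) * ‖J x‖ ^ 2 := by
    intro x
    have e : ∀ x, J (N x) = J (n x) + J ((s - 1) x) := fun x => by rw [← map_add]; rfl
    have e1 : inner ℝ (J (N x)) (J (N x)) =
        inner ℝ (J (N x)) (J (n x)) + inner ℝ (J (N x)) (J ((s - 1) x)) := by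
      rw [← inner_add_right, ← e]
    have e2 : inner ℝ (J (N (N x))) (J x) =
        inner ℝ (J (n (N x))) (J x) - inner ℝ (J (N x)) (J ((s - 1) x)) := by
      rw [e (N x), inner_add_left, hskew]; ring
    rw [e1, e2]
    have a1 := abs_real_inner_le_norm (J (N x)) (J (n x))
    have a2 := abs_real_inner_le_norm (J (n (N x))) (J x)
    have b1 : ‖J (N x)‖ * ‖J (n x)‖ ≤ (M + 1) * ‖J x‖ * (η * ‖J x‖) := by
      gcongr
      · exact hNn x
      · exact hJn x
    have b2 : ‖J (n (N x))‖ * ‖J x‖ ≤ η * ((M + 1) * ‖J x‖) * ‖J x‖ := by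
      gcongr
      exact (hJn _).trans (by gcongr; exact hNn x)
    rw [abs_le] at a1 a2 ⊢
    constructor <;> nlinarith
  have hself : ∀ x, h x x = ‖J (ι x)‖ ^ 2 := fun x => by rw [hh, real_inner_self_eq_norm_sq]
  refine ⟨h, fun x y => by rw [hh, hh, real_inner_comm], fun x hx => ?_, fun x => ?_, fun x => ?_⟩
  · rw [hself]
    have : J (ι x) ≠ 0 := fun h0 => hx (hι (hJinj (by rw [h0, map_zero, map_zero])))
    positivity
  · rw [hself, hh, hια, inner_add_left, real_inner_self_eq_norm_sq, hNx, add_sub_cancel_left]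
    refine (hest1 _).trans ?_
    gcongr
    nlinarith
  · have e2 : J (ι (α (α x))) = J (ι x) + (2 : ℝ) • J (N (ι x)) + J (N (N (ι x))) := by
      have : ι (α x) = ι x + N (ι x) := hJinj (by rw [hια, map_add])
      rw [hια, this, map_add, map_add, map_add, two_smul]
      abel
    rw [hself x, hh, hh, e2, hια]
    rw [inner_add_left, inner_add_right, inner_add_right, inner_add_left, inner_add_left,
      real_inner_smul_left, real_inner_self_eq_norm_sq,
      real_inner_comm (J (N (ι x))) (J (ι x)), hNx]
    have a1 := hest1 (ι x)
    have a2 := hest2 (ι x)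
    rw [abs_le] at a1 a2 ⊢
    have a3 : η * (4 + 2 * (M + 1)) * ‖J (ι x)‖ ^ 2 ≤ ε * ‖J (ι x)‖ ^ 2 := by gcongr
    constructor <;> nlinarith

/-! ### Riemannian metrics in a chart, and their curvature in a moving frame -/

section MetricConstruction

variable {E : Type*} [NormedAddCommGroup E] [NormedSpace ℝ E] [FiniteDimensional ℝ E]

/-- A positive definite bilinear form on a finite-dimensional space has bounded unit ball. -/
theorem isVonNBounded_setOf_apply_self_lt_one (B : E →L[ℝ] E →L[ℝ] ℝ)
    (hB : ∀ v, v ≠ 0 → 0 < B v v) : Bornology.IsVonNBounded ℝ {v : E | B v v < 1} := by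
  obtain ⟨c, hc, h⟩ : ∃ c > 0, ∀ v : E, ‖v‖ = 1 → c ≤ B v v := by
    by_cases hne : (Metric.sphere (0 : E) 1).Nonempty
    · obtain ⟨v₀, hv₀, hmin⟩ := (isCompact_sphere (0 : E) 1).exists_isMinOn hne
        (f := fun v => B v v) (by fun_prop)
      refine ⟨B v₀ v₀, hB _ fun h0 => ?_, fun v hv => hmin (by simpa using hv)⟩
      simp [h0] at hv₀
    · exact ⟨1, one_pos, fun v hv => (hne ⟨v, by simpa using hv⟩).elim⟩
  rw [NormedSpace.isVonNBounded_iff, isBounded_iff_forall_norm_le]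
  refine ⟨Real.sqrt c⁻¹, fun v hv => Real.le_sqrt_of_sq_le ?_⟩
  rcases eq_or_ne v 0 with rfl | hv0
  · simp [hc.le]
  have hn : 0 < ‖v‖ := norm_pos_iff.2 hv0
  have := h (‖v‖⁻¹ • v) (by rw [norm_smul, norm_inv, norm_norm, inv_mul_cancel₀ hn.ne'])
  simp only [map_smul, smul_apply, smul_eq_mul] at this
  have hv' : B v v < 1 := hv
  have h2 : c * ‖v‖ ^ 2 ≤ B v v := by
    calc c * ‖v‖ ^ 2 ≤ (‖v‖⁻¹ * (‖v‖⁻¹ * B v v)) * ‖v‖ ^ 2 := by gcongr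
      _ = B v v := by field_simp
  rw [← one_div, le_div_iff₀ hc]
  linarith

/-- A positive definite bilinear form identifies a finite-dimensional space with its dual. -/
theorem exists_equiv_dual_of_pos (B : E →L[ℝ] E →L[ℝ] ℝ) (hB : ∀ v, v ≠ 0 → 0 < B v v) :
    ∃ e : E ≃L[ℝ] (E →L[ℝ] ℝ), B = e := by
  have hinj : Function.Injective B := by
    rw [injective_iff_map_eq_zero]
    intro w hw
    by_contra hne
    have := hB w hne
    rw [hw] at this
    exact lt_irrefl _ this
  have hrank : Module.finrank ℝ E = Module.finrank ℝ (E →L[ℝ] ℝ) := by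
    rw [← (LinearMap.toContinuousLinearMap : (E →ₗ[ℝ] ℝ) ≃ₗ[ℝ] (E →L[ℝ] ℝ)).finrank_eq]
    exact (Subspace.dual_finrank_eq (K := ℝ) (V := E)).symm
  exact ⟨(LinearEquiv.ofInjectiveOfFinrankEq B.toLinearMap hinj hrank).toContinuousLinearEquiv,
    by ext; rfl⟩

/-- The Riemannian metric on a finite-dimensional vector space given in the global chart by a
smooth family of inner products. -/
def SmoothMetric.ofForm (f : E → E →L[ℝ] E →L[ℝ] ℝ) (hf : ContDiff ℝ ∞ f)
    (symm : ∀ x u v, f x u v = f x v u) (pos : ∀ x u, u ≠ 0 → 0 < f x u u) : SmoothMetric E where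
  inner x := f x
  symm := symm
  pos := pos
  isVonNBounded x := isVonNBounded_setOf_apply_self_lt_one (f x) (pos x)
  contMDiff := by
    intro x
    refine (Bundle.contMDiffAt_section _).2 ?_
    refine (hf.contDiffAt.contMDiffAt (x := x)).congr_of_eventuallyEq (.of_forall fun y => ?_)
    refine (congrArg Prod.snd (hom_trivializationAt_apply _ _ _)).trans ?_
    ext v w
    simp only [ContinuousLinearMap.inCoordinates]
    simp
    -- the fibre `E →L[ℝ] ℝ` of the inner bundle of linear maps is again trivialized by the identity
    rw [Bundle.Trivialization.linearMapAt_apply,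
      if_pos (by simp only [hom_trivializationAt_baseSet]; simp [chartAt_self_eq])]
    refine (DFunLike.congr_fun
      (congrArg Prod.snd (hom_trivializationAt_apply _ _ _)) w).trans ?_
    simp only [ContinuousLinearMap.inCoordinates]
    simp
    rfl

@[simp]
theorem SmoothMetric.form_ofForm (f : E → E →L[ℝ] E →L[ℝ] ℝ) (hf : ContDiff ℝ ∞ f)
    (symm : ∀ x u v, f x u v = f x v u) (pos : ∀ x u, u ≠ 0 → 0 < f x u u) (x : E) :
    (SmoothMetric.ofForm f hf symm pos).form x = f x := rfl

end MetricConstruction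

section FrameCurvature

variable {E : Type*} [NormedAddCommGroup E] [NormedSpace ℝ E]

/-- The data of a moving frame `P` on the vector space `E`, depending only on a linear coordinate
`τ`, with `P' = -A P`, together with an inner product `B` and a bilinear map `Γ` which satisfies
the Koszul formula for the metric `B (P ·, P ·)`, read in the frame. -/
structure IsLinearFrame (τ : E →L[ℝ] ℝ) (P Q : ℝ → E →L[ℝ] E) (A : E →L[ℝ] E)
    (B : E →L[ℝ] E →L[ℝ] ℝ) (Γ : E →L[ℝ] E →L[ℝ] E) : Prop where
  hasDerivAt : ∀ t, HasDerivAt P (-(A ∘L P t)) t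
  hasDerivAt_symm : ∀ t, HasDerivAt Q (Q t ∘L A) t
  symm_apply : ∀ t u, Q t (P t u) = u
  apply_symm : ∀ t u, P t (Q t u) = u
  coord : ∀ t u, τ (P t u) = τ u
  symm : ∀ u v, B u v = B v u
  pos : ∀ u, u ≠ 0 → 0 < B u u
  koszul : ∀ u v w, 2 * B (Γ u v) w = τ u * (-B (A v) w - B v (A w))
    + τ v * (-B (A u) w - B u (A w)) + τ w * (B (A u) v + B u (A v))

/-- The curvature tensor `R(u, v) w`, read in the frame, of the metric of an `IsLinearFrame`. -/
def frameCurvature (τ : E →L[ℝ] ℝ) (A : E →L[ℝ] E) (Γ : E →L[ℝ] E →L[ℝ] E) (u v w : E) : E :=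
  τ u • (A (Γ v w) - Γ (A v) w - Γ v (A w)) - τ v • (A (Γ u w) - Γ (A u) w - Γ u (A w))
    + Γ u (Γ v w) - Γ v (Γ u w)

namespace IsLinearFrame

variable {τ : E →L[ℝ] ℝ} {P Q : ℝ → E →L[ℝ] E} {A : E →L[ℝ] E}
    {B : E →L[ℝ] E →L[ℝ] ℝ} {Γ : E →L[ℝ] E →L[ℝ] E} {g : SmoothMetric E}

theorem hasDerivAt_apply (h : IsLinearFrame τ P Q A B Γ) (t : ℝ) (v : E) :
    HasDerivAt (fun t => P t v) (-(A (P t v))) t := by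
  simpa using (h.hasDerivAt t).clm_apply (hasDerivAt_const t v)

theorem fderiv_form (h : IsLinearFrame τ P Q A B Γ)
    (hg : ∀ x, g.form x = B.bilinearComp (P (τ x)) (P (τ x))) (x u v w : E) :
    fderiv ℝ g.form x u v w =
      τ u * (-B (A (P (τ x) v)) (P (τ x) w) - B (P (τ x) v) (A (P (τ x) w))) := by
  have hd : DifferentiableAt ℝ g.form x := by
    have e : g.form = fun x => ((ContinuousLinearMap.compL ℝ E E ℝ).flip (P (τ x))) ∘L
        (B ∘L P (τ x)) := by
      funext x
      rw [hg]
      rfl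
    have hP : DifferentiableAt ℝ (fun x => P (τ x)) x :=
      (h.hasDerivAt (τ x)).differentiableAt.comp x τ.differentiableAt
    rw [e]
    exact ((ContinuousLinearMap.compL ℝ E E ℝ).flip.differentiableAt.comp x hP).clm_comp
      ((differentiableAt_const B).clm_comp hP)
  have h0 : HasFDerivAt g.form (fderiv ℝ g.form x) x := hd.hasFDerivAt
  have h1 : HasFDerivAt (fun y => g.form y v) _ x := h0.clm_apply (hasFDerivAt_const v x)
  replace h1 := h1.clm_apply (hasFDerivAt_const w x)
  have h2 : HasFDerivAt (fun y => g.form y v w)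
      ((ContinuousLinearMap.toSpanSingleton ℝ
        (B (-(A (P (τ x) v))) (P (τ x) w) + B (P (τ x) v) (-(A (P (τ x) w))))) ∘L τ) x := by
    have hB : HasDerivAt (fun t => B (P t v) (P t w))
        (B (-(A (P (τ x) v))) (P (τ x) w) + B (P (τ x) v) (-(A (P (τ x) w)))) (τ x) :=
      ((B.hasFDerivAt.comp_hasDerivAt _ (h.hasDerivAt_apply (τ x) v))).clm_apply
        (h.hasDerivAt_apply (τ x) w)
    have e : (fun y => g.form y v w) = (fun t => B (P t v) (P t w)) ∘ τ := by
      funext y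
      rw [hg]
      rfl
    rw [e]
    exact hB.hasFDerivAt.comp x τ.hasFDerivAt
  have := DFunLike.congr_fun (h1.unique h2) u
  simp at this
  rw [this]
  ring

theorem christoffel_eq [FiniteDimensional ℝ E] (h : IsLinearFrame τ P Q A B Γ)
    (hg : ∀ x, g.form x = B.bilinearComp (P (τ x)) (P (τ x))) (x u v : E) :
    g.christoffel x u v = Q (τ x) (Γ (P (τ x) u) (P (τ x) v)) := by
  obtain ⟨e, he⟩ := exists_equiv_dual_of_pos (g.form x) (fun w hw => g.pos x w hw)
  rw [SmoothMetric.christoffel]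
  nth_rewrite 1 [he]
  rw [ContinuousLinearMap.inverse_equiv]
  change e.symm _ = _
  rw [ContinuousLinearEquiv.symm_apply_eq]
  ext w
  have e1 : (e (Q (τ x) (Γ (P (τ x) u) (P (τ x) v)))) w =
      B (Γ (P (τ x) u) (P (τ x) v)) (P (τ x) w) := by
    rw [← ContinuousLinearEquiv.coe_coe, ← he, hg]
    simp [h.apply_symm]
  rw [e1]
  have k := h.koszul (P (τ x) u) (P (τ x) v) (P (τ x) w)
  simp only [h.coord] at k
  simp only [smul_apply, sub_apply,
    add_apply, ContinuousLinearMap.flip_apply, h.fderiv_form hg,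
    smul_eq_mul]
  linarith

theorem fderiv_christoffel [FiniteDimensional ℝ E] (h : IsLinearFrame τ P Q A B Γ)
    (hg : ∀ x, g.form x = B.bilinearComp (P (τ x)) (P (τ x))) (x u v w : E) :
    fderiv ℝ (fun y => g.christoffel y v w) x u = τ u • Q (τ x)
      (A (Γ (P (τ x) v) (P (τ x) w)) - Γ (A (P (τ x) v)) (P (τ x) w)
        - Γ (P (τ x) v) (A (P (τ x) w))) := by
  have e : (fun y => g.christoffel y v w) = (fun t => Q t (Γ (P t v) (P t w))) ∘ τ := by
    funext y
    rw [h.christoffel_eq hg]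
    rfl
  have hd := (h.hasDerivAt_symm (τ x)).clm_apply
    ((Γ.hasFDerivAt.comp_hasDerivAt _ (h.hasDerivAt_apply (τ x) v)).clm_apply
      (h.hasDerivAt_apply (τ x) w))
  rw [e]
  refine (congrArg (fun L => L u) (hd.hasFDerivAt.comp x τ.hasFDerivAt).fderiv).trans ?_
  simp only [ContinuousLinearMap.comp_apply, ContinuousLinearMap.toSpanSingleton_apply, map_neg,
    neg_apply, map_add, map_sub, Function.comp_apply]
  congr 1
  abel

theorem curvature_eq [FiniteDimensional ℝ E] (h : IsLinearFrame τ P Q A B Γ)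
    (hg : ∀ x, g.form x = B.bilinearComp (P (τ x)) (P (τ x))) (x u v w : E) :
    g.curvature x u v w =
      Q (τ x) (frameCurvature τ A Γ (P (τ x) u) (P (τ x) v) (P (τ x) w)) := by
  rw [SmoothMetric.curvature, h.fderiv_christoffel hg, h.fderiv_christoffel hg,
    h.christoffel_eq hg, h.christoffel_eq hg, h.christoffel_eq hg, h.christoffel_eq hg,
    h.apply_symm, h.apply_symm, frameCurvature]
  simp only [h.coord, map_add, map_sub, map_smul]

theorem sec_eq [FiniteDimensional ℝ E] (h : IsLinearFrame τ P Q A B Γ)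
    (hg : ∀ x, g.form x = B.bilinearComp (P (τ x)) (P (τ x))) (x u v : E) :
    g.sec x u v = B (frameCurvature τ A Γ (P (τ x) u) (P (τ x) v) (P (τ x) v)) (P (τ x) u) /
      (B (P (τ x) u) (P (τ x) u) * B (P (τ x) v) (P (τ x) v) -
        B (P (τ x) u) (P (τ x) v) ^ 2) := by
  rw [SmoothMetric.sec, h.curvature_eq hg, hg]
  simp only [ContinuousLinearMap.bilinearComp_apply, h.apply_symm]

/-- Bounds on the curvature of all planes, read in the frame, bound all sectional curvatures. -/
theorem isPinched [FiniteDimensional ℝ E] (h : IsLinearFrame τ P Q A B Γ)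
    (hg : ∀ x, g.form x = B.bilinearComp (P (τ x)) (P (τ x))) {b : ℝ}
    (hb : ∀ u v : E,
      B (frameCurvature τ A Γ u v v) u ≤ -(B u u * B v v - B u v ^ 2) ∧
      -b ^ 2 * (B u u * B v v - B u v ^ 2) ≤ B (frameCurvature τ A Γ u v v) u) :
    g.IsPinched b := by
  intro x u v huv
  rw [h.sec_eq hg]
  set u' := P (τ x) u with hu
  set v' := P (τ x) v with hv
  have hli : ∀ s t : ℝ, s • u' + t • v' = 0 → s = 0 ∧ t = 0 := by
    intro s t hst
    refine LinearIndependent.pair_iff.1 huv s t ?_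
    rw [← h.symm_apply (τ x) (s • u + t • v), map_add, map_smul, map_smul, ← hu, ← hv, hst,
      map_zero]
  have hu0 : u' ≠ 0 := fun h0 => by simpa using hli 1 0 (by simp [h0])
  have huu := h.pos u' hu0
  -- strict Cauchy–Schwarz
  have hden : 0 < B u' u' * B v' v' - B u' v' ^ 2 := by
    have hw : B u' u' • v' - B u' v' • u' ≠ 0 := by
      intro h0
      have := hli (-B u' v') (B u' u') (by rw [← h0, neg_smul]; abel)
      exact huu.ne' this.2
    have := h.pos _ hw
    simp only [map_sub, map_smul, sub_apply, smul_apply,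
      smul_eq_mul, h.symm v' u'] at this
    have e : 0 < B u' u' * (B u' u' * B v' v' - B u' v' ^ 2) := by nlinarith
    exact pos_of_mul_pos_right e huu.le
  obtain ⟨h1, h2⟩ := hb u' v'
  constructor
  · rwa [le_div_iff₀ hden]
  · rw [div_le_iff₀ hden]; linarith

end IsLinearFrame

end FrameCurvature

/-! ### The left-invariant frame of a semidirect product and its curvature -/

namespace SemidirectLine

variable {V : Type*} [NormedAddCommGroup V] [NormedSpace ℝ V] {α : V →L[ℝ] V}

/-- The projection to the normal factor `V`. -/
def fstL (α : V →L[ℝ] V) : SemidirectLine α →L[ℝ] V := ContinuousLinearMap.fst ℝ V ℝ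

/-- The projection to the acting factor `ℝ`. -/
def sndL (α : V →L[ℝ] V) : SemidirectLine α →L[ℝ] ℝ := ContinuousLinearMap.snd ℝ V ℝ

/-- The inclusion of the normal factor `V`. -/
def inlL (α : V →L[ℝ] V) : V →L[ℝ] SemidirectLine α := ContinuousLinearMap.inl ℝ V ℝ

/-- The inclusion of the acting factor `ℝ`. -/
def inrL (α : V →L[ℝ] V) : ℝ →L[ℝ] SemidirectLine α := ContinuousLinearMap.inr ℝ V ℝ

@[simp] theorem fstL_inlL (v : V) : fstL α (inlL α v) = v := rfl
@[simp] theorem sndL_inlL (v : V) : sndL α (inlL α v) = 0 := rfl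
@[simp] theorem fstL_inrL (t : ℝ) : fstL α (inrL α t) = 0 := rfl
@[simp] theorem sndL_inrL (t : ℝ) : sndL α (inrL α t) = t := rfl

theorem inlL_add_inrL (u : SemidirectLine α) : inlL α (fstL α u) + inrL α (sndL α u) = u :=
  Prod.ext (add_zero u.1) (zero_add u.2)

@[ext]
theorem ext {u v : SemidirectLine α} (h1 : fstL α u = fstL α v) (h2 : sndL α u = sndL α v) :
    u = v := Prod.ext h1 h2

/-- The left-invariant coframe at the points of `V × {t}`: the tangent vector `(u, s)` has the
frame components `(exp (-tα) u - s ξ, s)`. -/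
def frame (α : V →L[ℝ] V) (ξ : V) (t : ℝ) : SemidirectLine α →L[ℝ] SemidirectLine α :=
  inlL α ∘L (flow α (-t) ∘L fstL α - (sndL α).smulRight ξ) + inrL α ∘L sndL α

/-- The inverse of `SemidirectLine.frame`. -/
def frameSymm (α : V →L[ℝ] V) (ξ : V) (t : ℝ) : SemidirectLine α →L[ℝ] SemidirectLine α :=
  inlL α ∘L flow α t ∘L (fstL α + (sndL α).smulRight ξ) + inrL α ∘L sndL α

/-- The negative logarithmic derivative of `SemidirectLine.frame`. -/
def frameGen (α : V →L[ℝ] V) (ξ : V) : SemidirectLine α →L[ℝ] SemidirectLine α :=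
  inlL α ∘L α ∘L (fstL α + (sndL α).smulRight ξ)

/-- The orthogonal sum of the inner product `h` and the square of the `ℝ`-coordinate, scaled by the
factor `c`. -/
def sumForm (α : V →L[ℝ] V) (h : V →L[ℝ] V →L[ℝ] ℝ) (c : ℝ) :
    SemidirectLine α →L[ℝ] SemidirectLine α →L[ℝ] ℝ :=
  c • (h.bilinearComp (fstL α) (fstL α) + (sndL α).smulRight (sndL α))

/-- The Levi-Civita connection in the frame; `D` is the `h`-symmetric part of `α`. -/
def frameChristoffel (α : V →L[ℝ] V) (h : V →L[ℝ] V →L[ℝ] ℝ) (ξ : V) (D : V →L[ℝ] V) :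
    SemidirectLine α →L[ℝ] SemidirectLine α →L[ℝ] SemidirectLine α :=
  (ContinuousLinearMap.compL ℝ (SemidirectLine α) ℝ (SemidirectLine α) (inrL α)) ∘L
      (h.bilinearComp (D ∘L fstL α) (fstL α))
    - (sndL α).smulRight (inlL α ∘L D ∘L fstL α)
    - ((sndL α).smulRight (inlL α ∘L D ∘L fstL α)).flip
    - (sndL α).smulRight ((sndL α).smulRight (inlL α (α ξ)))

section apply

variable (ξ : V) (t c : ℝ) (h : V →L[ℝ] V →L[ℝ] ℝ) (D : V →L[ℝ] V) (u v : SemidirectLine α)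

@[simp] theorem fstL_frame :
    fstL α (frame α ξ t u) = flow α (-t) (fstL α u) - sndL α u • ξ := by simp [frame]
@[simp] theorem sndL_frame : sndL α (frame α ξ t u) = sndL α u := by simp [frame]
@[simp] theorem fstL_frameSymm :
    fstL α (frameSymm α ξ t u) = flow α t (fstL α u + sndL α u • ξ) := by simp [frameSymm]
@[simp] theorem sndL_frameSymm : sndL α (frameSymm α ξ t u) = sndL α u := by simp [frameSymm]
@[simp] theorem fstL_frameGen :
    fstL α (frameGen α ξ u) = α (fstL α u + sndL α u • ξ) := by simp [frameGen]
@[simp] theorem sndL_frameGen : sndL α (frameGen α ξ u) = 0 := by simp [frameGen]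
theorem sumForm_apply : sumForm α h c u v =
    c * (h (fstL α u) (fstL α v) + sndL α u * sndL α v) := by simp [sumForm, mul_add]
@[simp] theorem fstL_frameChristoffel : fstL α (frameChristoffel α h ξ D u v) =
    -(sndL α u • D (fstL α v) + sndL α v • D (fstL α u) + (sndL α u * sndL α v) • α ξ) := by
  simp [frameChristoffel, mul_smul]; abel
@[simp] theorem sndL_frameChristoffel :
    sndL α (frameChristoffel α h ξ D u v) = h (D (fstL α u)) (fstL α v) := by
  simp [frameChristoffel]

end apply

theorem hasDerivAt_flow [CompleteSpace V] (α : V →L[ℝ] V) (t : ℝ) :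
    HasDerivAt (flow α) (α ∘L flow α t) t :=
  hasDerivAt_exp_smul_const' α t

theorem flow_comm [CompleteSpace V] (α : V →L[ℝ] V) (t : ℝ) : α ∘L flow α t = flow α t ∘L α :=
  (hasDerivAt_flow α t).unique (hasDerivAt_exp_smul_const α t)

theorem flow_neg_apply_flow [CompleteSpace V] (α : V →L[ℝ] V) (t : ℝ) (v : V) :
    flow α (-t) (flow α t v) = v := by
  have := flow_add α (-t) t
  rw [neg_add_cancel, flow_zero] at this
  exact (DFunLike.congr_fun this v).symm

theorem flow_apply_flow_neg [CompleteSpace V] (α : V →L[ℝ] V) (t : ℝ) (v : V) :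
    flow α t (flow α (-t) v) = v := by
  simpa using flow_neg_apply_flow α (-t) v

theorem contDiff_flow [CompleteSpace V] (α : V →L[ℝ] V) : ContDiff ℝ ∞ (flow α) := by
  have h : ContDiff ℝ ∞ (NormedSpace.exp : (V →L[ℝ] V) → (V →L[ℝ] V)) :=
    contDiff_iff_contDiffAt.2 fun x => (NormedSpace.exp_analytic (𝕂 := ℝ) x).contDiffAt
  exact h.comp (contDiff_id.smul contDiff_const)

/-- The symmetric part of `α` with respect to `h`. -/
theorem exists_symmetric_part [FiniteDimensional ℝ V] (α : V →L[ℝ] V) (h : V →L[ℝ] V →L[ℝ] ℝ)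
    (hpos : ∀ x, x ≠ 0 → 0 < h x x) :
    ∃ D : V →L[ℝ] V, ∀ x y, 2 * h (D x) y = h (α x) y + h x (α y) := by
  obtain ⟨e, he⟩ := exists_equiv_dual_of_pos h hpos
  refine ⟨(e.symm : (V →L[ℝ] ℝ) →L[ℝ] V) ∘L ((1 / 2 : ℝ) • (h ∘L α +
    h.bilinearComp (ContinuousLinearMap.id ℝ V) α)), fun x y => ?_⟩
  have he' : ∀ w, h (e.symm w) = w := fun w => by rw [he]; exact e.apply_symm_apply w
  simp [he']
  ring

theorem isLinearFrame [CompleteSpace V] {h : V →L[ℝ] V →L[ℝ] ℝ} {D : V →L[ℝ] V}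
    (hsymm : ∀ x y, h x y = h y x) (hpos : ∀ x, x ≠ 0 → 0 < h x x)
    (hD : ∀ x y, 2 * h (D x) y = h (α x) y + h x (α y)) {c : ℝ} (hc : 0 < c) (ξ : V) :
    IsLinearFrame (sndL α) (frame α ξ) (frameSymm α ξ) (frameGen α ξ) (sumForm α h c)
      (frameChristoffel α h ξ D) where
  hasDerivAt t := by
    have h1 : HasDerivAt (fun t => flow α (-t)) (-(α ∘L flow α (-t))) t := by
      refine ((hasDerivAt_flow α (-t)).scomp t (hasDerivAt_neg t)).congr_deriv ?_
      simp
    have h2 := (hasDerivAt_const t (inlL α)).clm_comp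
      ((h1.clm_comp (hasDerivAt_const t (fstL α))).sub_const ((sndL α).smulRight ξ))
    refine (h2.add_const (inrL α ∘L sndL α)).congr_deriv ?_
    ext u <;> simp
  hasDerivAt_symm t := by
    have h2 := (hasDerivAt_const t (inlL α)).clm_comp
      ((hasDerivAt_flow α t).clm_comp
        (hasDerivAt_const t (fstL α + (sndL α).smulRight ξ)))
    refine (h2.add_const (inrL α ∘L sndL α)).congr_deriv ?_
    rw [flow_comm]
    ext u <;> simp
  symm_apply t u := by ext <;> simp [flow_apply_flow_neg]
  apply_symm t u := by ext <;> simp [flow_neg_apply_flow]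
  coord t u := by simp
  symm u v := by rw [sumForm_apply, sumForm_apply, hsymm, mul_comm (sndL α u)]
  pos u hu := by
    rw [sumForm_apply]
    refine mul_pos hc ?_
    by_cases h0 : fstL α u = 0
    · have : sndL α u ≠ 0 := fun h1 => hu (by ext <;> simp [h0, h1])
      rw [h0]
      simpa using mul_self_pos.2 this
    · have := hpos _ h0
      nlinarith [mul_self_nonneg (sndL α u)]
  koszul u v w := by
    simp only [sumForm_apply, fstL_frameChristoffel, sndL_frameChristoffel, fstL_frameGen,
      sndL_frameGen, map_neg, map_add, map_smul, neg_apply,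
      add_apply, smul_apply, smul_eq_mul]
    have e1 := hD (fstL α v) (fstL α w)
    have e2 := hD (fstL α u) (fstL α w)
    have e3 := hD (fstL α u) (fstL α v)
    rw [hsymm (fstL α v) (α ξ), hsymm (fstL α u) (α ξ)]
    linear_combination c * (-(sndL α u) * e1 - sndL α v * e2 + sndL α w * e3)

/-- The curvature of the plane spanned by `u = (x, s)` and `v = (y, r)`. The slices `V × {t}` are
flat and their second fundamental form is `D`, which gives the first term; the second one is the
curvature of the planes containing the `ℝ`-direction, evaluated at the vector `r x - s y`. -/
theorem sumForm_frameCurvature {h : V →L[ℝ] V →L[ℝ] ℝ} {D : V →L[ℝ] V}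
    (hsymm : ∀ x y, h x y = h y x)
    (hD : ∀ x y, 2 * h (D x) y = h (α x) y + h x (α y)) (c : ℝ) (ξ : V)
    (u v : SemidirectLine α) {x y z : V} {s r : ℝ} (hx : fstL α u = x) (hy : fstL α v = y)
    (hs : sndL α u = s) (hr : sndL α v = r) (hz : z = r • x - s • y) :
    sumForm α h c (frameCurvature (sndL α) (frameGen α ξ) (frameChristoffel α h ξ D) u v v) u =
      -c * (h (D x) x * h (D y) y - h (D x) y ^ 2
        + (h (α z) (α z) + h (α (α z)) z - h (D z) (D z))) := by
  have hDs : ∀ x y, h (D x) y = h x (D y) := fun x y => by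
    have h1 := hD x y
    have h2 := hD y x
    rw [hsymm (D y) x, hsymm (α y) x, hsymm y (α x)] at h2
    linarith
  simp only [sumForm_apply, frameCurvature, map_add, map_sub, map_smul, map_neg,
    fstL_frameChristoffel, sndL_frameChristoffel, fstL_frameGen, sndL_frameGen, hx, hy, hs, hr, hz,
    neg_apply, sub_apply,
    add_apply, smul_apply, smul_eq_mul, smul_add, smul_neg]
  -- every term is expressed through `h (D ·) (D ·)`, `h (α ·) (α ·)`, `h (α (α ·)) ·`, `h (D ·) ·`
  have hDD : ∀ a b, h (D (D a)) b = h (D b) (D a) := fun a b => by rw [hDs, hsymm]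
  have hαD : ∀ a b, h (α (D a)) b = 2 * h (D b) (D a) - h (D a) (α b) := fun a b => by
    rw [← hDD, hD]; ring
  have hDα : ∀ a b, h (D (α a)) b = (h (α (α a)) b + h (α a) (α b)) / 2 := fun a b => by
    rw [← hD]; ring
  have hDα' : ∀ a b, h (D a) (α b) = (h (α a) (α b) + h (α (α b)) a) / 2 := fun a b => by
    rw [hsymm (α (α b)) a, ← hD]; ring
  have hDyx : h (D y) x = h (D x) y := by rw [hDs, hsymm]
  simp only [hαD, hDD, hDα, hDα', hDyx, hsymm (D y) (D x), hsymm (α y) (α x),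
    hsymm (α ξ) (α x), hsymm (α ξ) (α y)]
  ring

end SemidirectLine

/-! ### Pinching -/

section Gram

variable {V : Type*} [NormedAddCommGroup V] [NormedSpace ℝ V]

/-- The Cauchy–Schwarz inequality for a positive semidefinite bilinear form. -/
theorem apply_sq_le_of_nonneg (B : V →L[ℝ] V →L[ℝ] ℝ) (hs : ∀ x y, B x y = B y x)
    (hB : ∀ x, 0 ≤ B x x) (x y : V) : B x y ^ 2 ≤ B x x * B y y := by
  have h : ∀ t : ℝ, 0 ≤ B x x * (t * t) + (2 * B x y) * t + B y y := fun t => by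
    have := hB (t • x + y)
    simp only [map_add, map_smul, add_apply, smul_apply, smul_eq_mul, hs y x] at this
    linarith
  have := discrim_le_zero h
  rw [discrim] at this
  linarith

/-- Gram determinants of positive semidefinite forms are monotone. -/
theorem gram_le_gram {B C : V →L[ℝ] V →L[ℝ] ℝ} (hB : ∀ x y, B x y = B y x)
    (hC : ∀ x y, C x y = C y x) (h0 : ∀ x, 0 ≤ B x x) (hBC : ∀ x, B x x ≤ C x x) (x y : V) :
    B x x * B y y - B x y ^ 2 ≤ C x x * C y y - C x y ^ 2 := by
  have h1 := apply_sq_le_of_nonneg B hB h0 x y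
  have h2 := apply_sq_le_of_nonneg (C - B) (fun x y => by simp [hB x y, hC x y])
    (fun x => by simpa using hBC x) x y
  simp only [sub_apply] at h2
  have a1 := h0 x
  have a2 := h0 y
  have b1 := hBC x
  have b2 := hBC y
  set p1 := B x x
  set p2 := B x y
  set p3 := B y y
  obtain ⟨q1, hq1⟩ : ∃ q, C x x = p1 + q := ⟨C x x - p1, by ring⟩
  obtain ⟨q2, hq2⟩ : ∃ q, C x y = p2 + q := ⟨C x y - p2, by ring⟩
  obtain ⟨q3, hq3⟩ : ∃ q, C y y = p3 + q := ⟨C y y - p3, by ring⟩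
  rw [hq1] at b1
  rw [hq3] at b2
  rw [hq1, hq2, hq3] at h2 ⊢
  simp only [add_sub_cancel_left] at h2
  have c1 : 0 ≤ q1 := by linarith
  have c3 : 0 ≤ q3 := by linarith
  -- the mixed term: `p₁ q₃ + q₁ p₃ ≥ 2 √(p₁ p₃ q₁ q₃) ≥ 2 |p₂ q₂|`
  have key : 2 * (p2 * q2) ≤ p1 * q3 + q1 * p3 := by
    refine abs_le_of_sq_le_sq' ?_ (by positivity) |>.2
    have : p2 ^ 2 * q2 ^ 2 ≤ (p1 * p3) * (q1 * q3) := by gcongr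
    nlinarith [sq_nonneg (p1 * q3 - q1 * p3)]
  nlinarith

end Gram

namespace SemidirectLine

variable {V : Type*} [NormedAddCommGroup V] [NormedSpace ℝ V] [CompleteSpace V] {α : V →L[ℝ] V}

theorem contDiff_frame (α : V →L[ℝ] V) (ξ : V) : ContDiff ℝ ∞ (frame α ξ) := by
  have h1 : ContDiff ℝ ∞ (fun t : ℝ => flow α (-t)) := (contDiff_flow α).comp contDiff_neg
  exact (contDiff_const.clm_comp ((h1.clm_comp contDiff_const).sub contDiff_const)).add
    contDiff_const

theorem contDiff_frameForm (B : SemidirectLine α →L[ℝ] SemidirectLine α →L[ℝ] ℝ) (ξ : V) :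
    ContDiff ℝ ∞ fun x : SemidirectLine α =>
      B.bilinearComp (frame α ξ (sndL α x)) (frame α ξ (sndL α x)) := by
  have hP : ContDiff ℝ ∞ fun x : SemidirectLine α => frame α ξ (sndL α x) :=
    (contDiff_frame α ξ).comp (sndL α).contDiff
  exact ((ContinuousLinearMap.compL ℝ (SemidirectLine α) (SemidirectLine α) ℝ).flip.contDiff.comp
    hP).clm_comp (contDiff_const.clm_comp hP)

variable [FiniteDimensional ℝ V]

/-- The left-invariant metric which on the Lie algebra `V × ℝ` is the inner product `c h` on `V`,
with `(ξ, 1)` orthogonal to `V` and of square length `c`. -/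
def metric (h : V →L[ℝ] V →L[ℝ] ℝ) (hsymm : ∀ x y, h x y = h y x)
    (hpos : ∀ x, x ≠ 0 → 0 < h x x) (ξ : V) {c : ℝ} (hc : 0 < c) :
    SmoothMetric (SemidirectLine α) :=
  SmoothMetric.ofForm
    (fun x => (sumForm α h c).bilinearComp (frame α ξ (sndL α x)) (frame α ξ (sndL α x)))
    (contDiff_frameForm _ ξ)
    (fun x u v => by
      obtain ⟨D, hD⟩ := exists_symmetric_part α h hpos
      exact (isLinearFrame hsymm hpos hD hc ξ).symm _ _)
    (fun x u hu => by
      obtain ⟨D, hD⟩ := exists_symmetric_part α h hpos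
      have H := isLinearFrame hsymm hpos hD hc ξ
      refine H.pos _ fun h0 => hu ?_
      exact (H.symm_apply (sndL α x) u).symm.trans ((congrArg _ h0).trans (map_zero _)))

theorem form_metric_apply {h : V →L[ℝ] V →L[ℝ] ℝ} (hsymm : ∀ x y, h x y = h y x)
    (hpos : ∀ x, x ≠ 0 → 0 < h x x) (ξ : V) {c : ℝ} (hc : 0 < c) (x u v : SemidirectLine α) :
    (metric (α := α) h hsymm hpos ξ hc).form x u v =
      c * (h (flow α (-sndL α x) (fstL α u) - sndL α u • ξ)
          (flow α (-sndL α x) (fstL α v) - sndL α v • ξ) + sndL α u * sndL α v) := by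
  rw [metric, SmoothMetric.form_ofForm, ContinuousLinearMap.bilinearComp_apply, sumForm_apply]
  simp

theorem isPinched_metric {h : V →L[ℝ] V →L[ℝ] ℝ} {ε : ℝ} (hh : IsAdaptedInner α ε h)
    (hε0 : 0 ≤ ε) (hε1 : ε ≤ 1) (ξ : V) {c : ℝ} (hc : 0 < c) (hcε : c ≤ 1 - 4 * ε) {b : ℝ}
    (hb : 1 + 4 * ε ≤ b ^ 2 * c) :
    (metric (α := α) h hh.symm hh.pos ξ hc).IsPinched b := by
  obtain ⟨D, hD⟩ := exists_symmetric_part α h hh.pos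
  have h0 : ∀ x, 0 ≤ h x x := fun x => by
    rcases eq_or_ne x 0 with rfl | hx
    · simp
    · exact (hh.pos x hx).le
  have hDs : ∀ x y, h (D x) y = h (D y) x := fun x y => by
    have h1 := hD x y
    have h2 := hD y x
    rw [hh.symm (α y) x, hh.symm y (α x)] at h2
    linarith
  have hD1 : ∀ x, (1 - ε) * h x x ≤ h (D x) x ∧ h (D x) x ≤ (1 + ε) * h x x := fun x => by
    have h1 := hD x x
    have h2 := abs_le.1 (hh.first x)
    rw [hh.symm x (α x)] at h1
    constructor <;> linarith
  have hε1' : 0 ≤ 1 - ε := by linarith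
  have hDnn : ∀ x, 0 ≤ h (D x) x := fun x =>
    (mul_nonneg hε1' (h0 x)).trans (hD1 x).1
  have hG0 : ∀ x y, 0 ≤ h x x * h y y - h x y ^ 2 := fun x y => by
    linarith [apply_sq_le_of_nonneg h hh.symm h0 x y]
  -- the planes tangent to `V`: the second exterior power of `D` is close to the identity
  have hgram : ∀ x y, (1 - 4 * ε) * (h x x * h y y - h x y ^ 2) ≤
        h (D x) x * h (D y) y - h (D x) y ^ 2 ∧
      h (D x) x * h (D y) y - h (D x) y ^ 2 ≤
        (1 + 4 * ε) * (h x x * h y y - h x y ^ 2) := by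
    intro x y
    have l := gram_le_gram (B := (1 - ε) • h) (C := h ∘L D) (fun x y => by simp [hh.symm x y])
      hDs (fun x => by simpa using mul_nonneg hε1' (h0 x)) (fun x => by simpa using (hD1 x).1) x y
    have u := gram_le_gram (B := h ∘L D) (C := (1 + ε) • h) hDs (fun x y => by simp [hh.symm x y])
      hDnn (fun x => by simpa using (hD1 x).2) x y
    simp only [smul_apply, smul_eq_mul, ContinuousLinearMap.comp_apply] at l u
    have hG := hG0 x y
    constructor
    · have : (1 - 4 * ε) * (h x x * h y y - h x y ^ 2) ≤
          (1 - ε) ^ 2 * (h x x * h y y - h x y ^ 2) := by gcongr; nlinarith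
      linarith
    · have : (1 + ε) ^ 2 * (h x x * h y y - h x y ^ 2) ≤
          (1 + 4 * ε) * (h x x * h y y - h x y ^ 2) := by gcongr; nlinarith
      linarith
  -- the planes containing the `ℝ`-direction
  have hq : ∀ z, (1 - 4 * ε) * h z z ≤ h (α z) (α z) + h (α (α z)) z - h (D z) (D z) ∧
      h (α z) (α z) + h (α (α z)) z - h (D z) (D z) ≤ (1 + 4 * ε) * h z z := by
    intro z
    have h2 := abs_le.1 (hh.second z)
    have hz := h0 z
    have lower : (1 - ε) ^ 2 * h z z ≤ h (D z) (D z) := by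
      have cs := apply_sq_le_of_nonneg h hh.symm h0 (D z) z
      have := (hD1 z).1
      rcases hz.eq_or_lt with hz0 | hzp
      · rw [← hz0, mul_zero]; exact h0 _
      · have : ((1 - ε) * h z z) ^ 2 ≤ h (D z) z ^ 2 := by gcongr
        refine le_of_mul_le_mul_right ?_ hzp
        nlinarith
    have upper : h (D z) (D z) ≤ (1 + ε) ^ 2 * h z z := by
      have cs := apply_sq_le_of_nonneg (h ∘L D) hDs hDnn z (D z)
      simp only [ContinuousLinearMap.comp_apply] at cs
      rcases (h0 (D z)).eq_or_lt with hw0 | hwp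
      · rw [← hw0]; positivity
      · have : h (D z) z * h (D (D z)) (D z) ≤ (1 + ε) * h z z * ((1 + ε) * h (D z) (D z)) := by
          gcongr
          · exact hDnn _
          · exact (hD1 _).2
          · exact (hD1 _).2
        refine le_of_mul_le_mul_right ?_ hwp
        nlinarith
    have e1 : (ε * ε) * h z z ≤ ε * h z z := by gcongr; nlinarith
    have e2 : 0 ≤ (ε * ε) * h z z := by positivity
    constructor <;> nlinarith
  refine (isLinearFrame hh.symm hh.pos hD hc ξ).isPinched (fun x => rfl) fun u v => ?_
  rw [sumForm_frameCurvature hh.symm hD c ξ u v rfl rfl rfl rfl rfl]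
  simp only [sumForm_apply]
  set x := fstL α u
  set y := fstL α v
  set s := sndL α u
  set r := sndL α v
  obtain ⟨z, hz⟩ : ∃ z, z = r • x - s • y := ⟨_, rfl⟩
  have hzz : h z z = r ^ 2 * h x x - 2 * (r * s) * h x y + s ^ 2 * h y y := by
    rw [hz]
    simp only [map_sub, map_smul, sub_apply, smul_apply, smul_eq_mul, hh.symm y x]
    ring
  rw [← hz]
  have den : c * (h x x + s * s) * (c * (h y y + r * r)) - (c * (h x y + s * r)) ^ 2 =
      c * (c * ((h x x * h y y - h x y ^ 2) + h z z)) := by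
    rw [hzz]; ring
  rw [den]
  obtain ⟨g1, g2⟩ := hgram x y
  obtain ⟨q1, q2⟩ := hq z
  set K := h (D x) x * h (D y) y - h (D x) y ^ 2 +
    (h (α z) (α z) + h (α (α z)) z - h (D z) (D z)) with hK
  set Gz := (h x x * h y y - h x y ^ 2) + h z z with hGz
  have hGz0 : 0 ≤ Gz := add_nonneg (hG0 x y) (h0 z)
  have k1 : c * Gz ≤ K := (mul_le_mul_of_nonneg_right hcε hGz0).trans (by linarith)
  have k2 : K ≤ b ^ 2 * c * Gz := le_trans (by linarith) (mul_le_mul_of_nonneg_right hb hGz0)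
  have m1 := mul_le_mul_of_nonneg_left k1 hc.le
  have m2 := mul_le_mul_of_nonneg_left k2 hc.le
  constructor <;> linarith

end SemidirectLine

/-! ### Left translations and automorphisms -/

namespace SemidirectLine

theorem flow_apply_comm {V : Type*} [NormedAddCommGroup V] [NormedSpace ℝ V] {α : V →L[ℝ] V}
    {A : V →L[ℝ] V} (hA : ∀ v, A (α v) = α (A v)) (t : ℝ) (v : V) :
    A (flow α t v) = flow α t (A v) := by
  have h : Commute A (t • α) := Commute.smul_right (ContinuousLinearMap.ext hA) t
  let _ : NormedAlgebra ℚ (V →L[ℝ] V) := NormedAlgebra.restrictScalars ℚ ℝ (V →L[ℝ] V)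
  exact DFunLike.congr_fun (h.exp_right).eq v

/-- If all complex eigenvalues of `α` have real part `1`, then `l α` can be conjugate to `α` only
for `l = 1`: over `ℂ`, conjugation maps eigenvectors of `α` to eigenvectors of `l α`. -/
theorem eq_one_of_conj_smul {V : Type*} [NormedAddCommGroup V] [NormedSpace ℝ V]
    {α : V →L[ℝ] V} [FiniteDimensional ℝ V] [Nontrivial V]
    (hα : spectrum ℂ (LinearMap.baseChange ℂ α.toLinearMap : Module.End ℂ (ℂ ⊗[ℝ] V)) ⊆
      {z : ℂ | z.re = 1}) {A : V →L[ℝ] V} (hA : Function.Injective A) {l : ℝ}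
    (hl : ∀ v, A (α v) = l • α (A v)) : l = 1 := by
  set αC : Module.End ℂ (ℂ ⊗[ℝ] V) := LinearMap.baseChange ℂ α.toLinearMap with hαC
  let AC : Module.End ℂ (ℂ ⊗[ℝ] V) := LinearMap.baseChange ℂ A.toLinearMap
  have hAC : Function.Injective AC :=
    Module.Flat.lTensor_preserves_injective_linearMap (M := ℂ) A.toLinearMap hA
  have hcomm : ∀ x, AC (αC x) = (l : ℂ) • αC (AC x) := by
    have : AC ∘ₗ αC = (l : ℂ) • (αC ∘ₗ AC) := by
      ext v
      simp only [AC, hαC, LinearMap.comp_apply, LinearMap.smul_apply,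
        TensorProduct.AlgebraTensorModule.curry_apply,
        TensorProduct.curry_apply, LinearMap.coe_restrictScalars, LinearMap.baseChange_tmul,
        ContinuousLinearMap.coe_coe, hl, TensorProduct.tmul_smul]
      exact (Complex.coe_smul l _).symm
    exact fun x => LinearMap.congr_fun this x
  have : Nontrivial (ℂ ⊗[ℝ] V) := inferInstance
  obtain ⟨z, hz⟩ := Module.End.exists_eigenvalue αC
  obtain ⟨v, hv⟩ := hz.exists_hasEigenvector
  have hzre : z.re = 1 := hα hz.mem_spectrum
  have hAv : AC v ≠ 0 := fun h0 => hv.2 (hAC (by rw [h0, map_zero]))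
  have h1 : z • AC v = (l : ℂ) • αC (AC v) := by
    rw [← hcomm, hv.apply_eq_smul, map_smul]
  have hl0 : (l : ℂ) ≠ 0 := by
    intro h0
    rw [h0, zero_smul] at h1
    rcases smul_eq_zero.1 h1 with h2 | h2
    · rw [h2] at hzre; simp at hzre
    · exact hAv h2
  have h2 : αC (AC v) = ((l : ℂ)⁻¹ * z) • AC v := by
    rw [mul_smul, h1, smul_smul, inv_mul_cancel₀ hl0, one_smul]
  have h3 : ((l : ℂ)⁻¹ * z).re = 1 := hα (Module.End.hasEigenvalue_of_hasEigenvector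
    ⟨Module.End.mem_eigenspace_iff.2 h2, hAv⟩).mem_spectrum
  rw [← Complex.ofReal_inv, Complex.re_ofReal_mul, hzre, mul_one] at h3
  exact inv_eq_one.1 h3

variable {V : Type*} [NormedAddCommGroup V] [NormedSpace ℝ V] [CompleteSpace V] {α : V →L[ℝ] V}

@[simp] theorem fstL_mul (p q : SemidirectLine α) :
    fstL α (p * q) = fstL α p + flow α (sndL α p) (fstL α q) := rfl
@[simp] theorem sndL_mul (p q : SemidirectLine α) :
    sndL α (p * q) = sndL α p + sndL α q := rfl

theorem flow_add_apply (α : V →L[ℝ] V) (s t : ℝ) (v : V) :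
    flow α (s + t) v = flow α s (flow α t v) := by
  rw [flow_add]; rfl

theorem hasDerivAt_flow_apply (α : V →L[ℝ] V) (t : ℝ) (v : V) :
    HasDerivAt (fun t => flow α t v) (α (flow α t v)) t := by
  simpa using (hasDerivAt_flow α t).clm_apply (hasDerivAt_const t v)

theorem isLeftInvariantMetric_metric [FiniteDimensional ℝ V] {h : V →L[ℝ] V →L[ℝ] ℝ}
    (hsymm : ∀ x y, h x y = h y x) (hpos : ∀ x, x ≠ 0 → 0 < h x x) (ξ : V) {c : ℝ} (hc : 0 < c) :
    IsLeftInvariantMetric (metric (α := α) h hsymm hpos ξ hc) := by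
  intro p
  let L : SemidirectLine α →L[ℝ] SemidirectLine α :=
    inlL α ∘L flow α (sndL α p) ∘L fstL α + inrL α ∘L sndL α
  have e : (fun x => p * x) = fun x => p + L x := by
    funext x
    ext <;> simp [L]
  rw [e]
  refine ⟨contDiff_const.add L.contDiff, fun x u v => ?_⟩
  rw [((L.hasFDerivAt (x := x)).const_add p).fderiv, form_metric_apply, form_metric_apply]
  have h1 : ∀ w, flow α (-sndL α (p + L x)) (fstL α (L w)) =
      flow α (-sndL α x) (fstL α w) := by
    intro w
    have e1 : -sndL α (p + L x) = -sndL α x + -sndL α p := by simp [L]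
    have e2 : fstL α (L w) = flow α (sndL α p) (fstL α w) := by simp [L]
    rw [e1, e2, flow_add_apply, flow_neg_apply_flow]
  have h2 : ∀ w, sndL α (L w) = sndL α w := fun w => by simp [L]
  simp only [h1, h2]

/-- The map `(v, t) ↦ (A v + exp (tα) w - w, t)`: the automorphism `(v, t) ↦ (A v, t)` followed by
conjugation with the element `(-w, 0)`, if `A` commutes with `α`. -/
def affineAut (A : V →L[ℝ] V) (w : V) (x : SemidirectLine α) : SemidirectLine α :=
  inlL α (A (fstL α x) + flow α (sndL α x) w - w) + inrL α (sndL α x)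

theorem hasFDerivAt_affineAut (A : V →L[ℝ] V) (w : V) (x : SemidirectLine α) :
    HasFDerivAt (affineAut A w)
      (inlL α ∘L (A ∘L fstL α + (sndL α).smulRight (α (flow α (sndL α x) w))) +
        inrL α ∘L sndL α) x := by
  have h1 : HasFDerivAt (fun x => flow α (sndL α x) w)
      ((sndL α).smulRight (α (flow α (sndL α x) w))) x := by
    refine ((hasDerivAt_flow_apply α (sndL α x) w).hasFDerivAt.comp x
      (sndL α).hasFDerivAt).congr_fderiv ?_
    ext u
    simp
  exact ((inlL α).hasFDerivAt.comp x (((A ∘L fstL α).hasFDerivAt.add h1).sub_const w)).add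
    (inrL α ∘L sndL α).hasFDerivAt

theorem contDiff_affineAut (A : V →L[ℝ] V) (w : V) :
    ContDiff ℝ ∞ (affineAut A w : SemidirectLine α → SemidirectLine α) := by
  have h1 : ContDiff ℝ ∞ fun x : SemidirectLine α => flow α (sndL α x) w :=
    ((contDiff_flow α).comp (sndL α).contDiff).clm_apply contDiff_const
  exact ((inlL α).contDiff.comp (((A ∘L fstL α).contDiff.add h1).sub contDiff_const)).add
    (inrL α ∘L sndL α).contDiff

theorem isInvariantUnder_affineAut [FiniteDimensional ℝ V] {h : V →L[ℝ] V →L[ℝ] ℝ}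
    (hsymm : ∀ x y, h x y = h y x) (hpos : ∀ x, x ≠ 0 → 0 < h x x) {ξ : V} {c : ℝ} (hc : 0 < c)
    {A : V →L[ℝ] V} {w : V} (hA : ∀ v, A (α v) = α (A v)) (hh : ∀ x y, h (A x) (A y) = h x y)
    (hξ : A ξ + α w = ξ) :
    (metric (α := α) h hsymm hpos ξ hc).IsInvariantUnder (affineAut A w) := by
  refine ⟨contDiff_affineAut A w, fun x u v => ?_⟩
  rw [(hasFDerivAt_affineAut A w x).fderiv, form_metric_apply, form_metric_apply]
  have h1 : sndL α (affineAut A w x) = sndL α x := by simp [affineAut]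
  have h2 : ∀ u : SemidirectLine α, flow α (-sndL α x) (A (fstL α u) +
      sndL α u • α (flow α (sndL α x) w)) - sndL α u • ξ =
      A (flow α (-sndL α x) (fstL α u) - sndL α u • ξ) := by
    intro u
    have hα : α (flow α (sndL α x) w) = flow α (sndL α x) (α w) :=
      DFunLike.congr_fun (flow_comm α _) w
    rw [map_add, map_smul, hα, flow_neg_apply_flow, map_sub, map_smul,
      flow_apply_comm hA, eq_sub_of_add_eq hξ]
    rw [smul_sub]
    abel
  simp only [h1, add_apply, ContinuousLinearMap.comp_apply, map_add, fstL_inlL, sndL_inlL,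
    fstL_inrL, sndL_inrL, add_zero, zero_add, ContinuousLinearMap.smulRight_apply] at h2 ⊢
  rw [h2, h2, hh]

/-- The operator `exp α - 1` is injective, since `exp (tα)` expands an adapted inner product. -/
theorem flow_one_injective {ε : ℝ} (hε : ε < 1) {h : V →L[ℝ] V →L[ℝ] ℝ}
    (hh : IsAdaptedInner α ε h) : Function.Injective (flow α 1 - (1 : V →L[ℝ] V)) := by
  rw [injective_iff_map_eq_zero]
  intro x hx
  by_contra h0
  -- the length of `exp (tα) x` increases strictly with `t`
  have hm : StrictMono fun t => h (flow α t x) (flow α t x) := by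
    refine strictMono_of_deriv_pos fun t => ?_
    have hd := (h.hasFDerivAt.comp_hasDerivAt t (hasDerivAt_flow_apply α t x)).clm_apply
      (hasDerivAt_flow_apply α t x)
    refine lt_of_lt_of_eq ?_ hd.deriv.symm
    have hne : flow α t x ≠ 0 := fun h1 => h0 (by rw [← flow_neg_apply_flow α t x, h1, map_zero])
    have hp := hh.pos _ hne
    have h1 := (abs_le.1 (hh.first (flow α t x))).1
    have h2 := hh.symm (flow α t x) (α (flow α t x))
    simp only [Function.comp_apply]
    nlinarith
  have h1 := hm one_pos
  have e : flow α 1 x = x := by simpa [sub_eq_zero] using hx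
  simp [e, flow_zero] at h1

/-- Every continuous automorphism acts on the quotient by `V`, which is the line, trivially, and is
of the form `SemidirectLine.affineAut`. -/
theorem exists_eq_affineAut [FiniteDimensional ℝ V] [Nontrivial V]
    (hα : spectrum ℂ (LinearMap.baseChange ℂ α.toLinearMap : Module.End ℂ (ℂ ⊗[ℝ] V)) ⊆
      {z : ℂ | z.re = 1}) (φ : MulAut (SemidirectLine α)) (hφ : Continuous φ) :
    ∃ (A : V →L[ℝ] V) (w : V), (∀ v, A (α v) = α (A v)) ∧ ∀ x, φ x = affineAut A w x := by
  obtain ⟨h, hh⟩ := exists_isAdaptedInner α hα (ε := 1 / 2) (by norm_num)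
  have hinj := flow_one_injective (by norm_num) hh
  have hsurj : Function.Surjective (flow α 1 - (1 : V →L[ℝ] V)) :=
    LinearMap.surjective_of_injective (f := (flow α 1 - (1 : V →L[ℝ] V)).toLinearMap) hinj
  -- `V` is preserved, since its elements are commutators
  have hV : ∀ v, sndL α (φ (inlL α v)) = 0 := by
    intro v
    obtain ⟨u, hu⟩ := hsurj v
    have hu' : flow α 1 u = v + u := by
      rw [← hu]; simp
    have e : inrL α 1 * inlL α u = inlL α v * inlL α u * inrL α 1 := by
      ext <;> simp [hu', flow_zero]
    have := congrArg (sndL α) (congrArg φ e)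
    simp only [map_mul, sndL_mul] at this
    linarith
  let A₀ : V →+ V := AddMonoidHom.mk' (fun v => fstL α (φ (inlL α v))) fun v w => by
    have e : inlL α (v + w) = inlL α v * inlL α w := by ext <;> simp [flow_zero]
    rw [e, map_mul, fstL_mul, hV, flow_zero]
    rfl
  have hA₀ : Continuous A₀ := (fstL α).continuous.comp (hφ.comp (inlL α).continuous)
  let A : V →L[ℝ] V := A₀.toRealLinearMap hA₀
  have hAφ : ∀ v, φ (inlL α v) = inlL α (A v) := fun v => by
    ext
    · rfl
    · rw [hV]; rfl
  have hAinj : Function.Injective A := fun v w hvw => by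
    have : inlL α v = inlL α w := φ.injective (by rw [hAφ, hAφ, hvw])
    simpa using congrArg (fstL α) this
  have hmulr : ∀ s t, inrL α (s + t) = inrL α s * inrL α t := fun s t => by
    ext <;> simp
  let T₀ : ℝ →+ ℝ := AddMonoidHom.mk' (fun t => sndL α (φ (inrL α t))) fun s t => by
    rw [hmulr, map_mul, sndL_mul]
  have hT₀ : Continuous T₀ := (sndL α).continuous.comp (hφ.comp (inrL α).continuous)
  let T : ℝ →L[ℝ] ℝ := T₀.toRealLinearMap hT₀
  have hT : ∀ t, sndL α (φ (inrL α t)) = t * T 1 := fun t => by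
    have : T (t • 1) = t • T 1 := map_smul _ _ _
    rw [smul_eq_mul, mul_one, smul_eq_mul] at this
    exact this
  have hAflow : ∀ t v, flow α (t * T 1) (A v) = A (flow α t v) := by
    intro t v
    have e : inrL α t * inlL α v = inlL α (flow α t v) * inrL α t := by
      ext <;> simp [flow_zero]
    have := congrArg (fstL α) (congrArg φ e)
    simp only [map_mul, fstL_mul, hAφ, hT, fstL_inlL, sndL_inlL, flow_zero] at this
    rw [add_comm] at this
    exact add_right_cancel this
  have hAα : ∀ v, A (α v) = T 1 • α (A v) := by
    intro v
    have d1 : HasDerivAt (fun t => flow α (t * T 1) (A v)) _ 0 :=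
      HasDerivAt.scomp (h := fun t => t * T 1) (0 : ℝ)
        (hasDerivAt_flow_apply α ((0 : ℝ) * T 1) (A v)) (hasDerivAt_mul_const (T 1))
    have d2 : HasDerivAt (fun t => A (flow α t v)) _ 0 :=
      A.hasFDerivAt.comp_hasDerivAt (0 : ℝ) (hasDerivAt_flow_apply α 0 v)
    have d3 := d1.unique (d2.congr_of_eventuallyEq (.of_forall fun t => hAflow t v))
    simpa [flow_zero] using d3.symm
  have hT1 : T 1 = 1 := eq_one_of_conj_smul hα hAinj hAα
  -- the translation part is a cocycle on the line, hence a coboundary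
  obtain ⟨w, hw⟩ := hsurj (fstL α (φ (inrL α 1)))
  have hc : ∀ s t, fstL α (φ (inrL α (s + t))) =
      fstL α (φ (inrL α s)) + flow α s (fstL α (φ (inrL α t))) := fun s t => by
    rw [hmulr, map_mul, fstL_mul, hT, hT1, mul_one]
  have hcw : ∀ t, fstL α (φ (inrL α t)) = flow α t w - w := by
    intro t
    apply hinj
    have e1 := hc t 1
    rw [add_comm t 1, hc 1 t, ← hw] at e1
    have e2 : flow α t (flow α 1 w) = flow α 1 (flow α t w) := by
      rw [← flow_add_apply, ← flow_add_apply, add_comm]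
    simp only [sub_apply, one_apply_eq_self, map_sub, e2] at e1 ⊢
    generalize fstL α (φ (inrL α t)) = c at *
    have : flow α 1 c = c + (flow α 1 (flow α t w) - flow α t w) - (flow α 1 w - w) := by
      rw [← e1]; abel
    rw [this]
    abel
  refine ⟨A, w, fun v => by rw [hAα, hT1, one_smul], fun x => ?_⟩
  have e : x = inlL α (fstL α x) * inrL α (sndL α x) := by
    ext <;> simp
  conv_lhs => rw [e]
  rw [map_mul, hAφ]
  ext
  · simp [affineAut, hcw, flow_zero, add_sub_assoc]
  · simp [affineAut, hT, hT1]

end SemidirectLine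

/-! ### Compact groups of automorphisms -/

namespace SemidirectLine

variable {V : Type*} [NormedAddCommGroup V] [NormedSpace ℝ V] {α : V →L[ℝ] V}

open MeasureTheory in
/-- Averaging over a compact group `H` of linear maps which induce the identity on the quotient by
`V` and commute with `α` on `V`: there are an invariant vector `(ξ, 1)`, and an invariant inner
product on `V`, which inherits the estimates of any given one. -/
theorem exists_invariant_isAdaptedInner [FiniteDimensional ℝ V] {ε : ℝ} {h₀ : V →L[ℝ] V →L[ℝ] ℝ}
    (hh : IsAdaptedInner α ε h₀)
    (H : Subgroup (SemidirectLine α →L[ℝ] SemidirectLine α)ˣ)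
    (hH : IsCompact (H : Set (SemidirectLine α →L[ℝ] SemidirectLine α)ˣ))
    (hsnd : ∀ M ∈ H, ∀ u, sndL α (M.val u) = sndL α u)
    (hcomm : ∀ M ∈ H, ∀ v, fstL α (M.val (inlL α (α v))) = α (fstL α (M.val (inlL α v)))) :
    ∃ (h : V →L[ℝ] V →L[ℝ] ℝ) (ξ : V), IsAdaptedInner α ε h ∧ ∀ M ∈ H,
      (∀ x y, h (fstL α (M.val (inlL α x))) (fstL α (M.val (inlL α y))) = h x y) ∧
        M.val (inlL α ξ + inrL α 1) = inlL α ξ + inrL α 1 := by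
  have : CompactSpace H := isCompact_iff_compactSpace.1 hH
  let _ : MeasurableSpace H := borel H
  have : BorelSpace H := ⟨rfl⟩
  let μ : Measure H := Measure.haarMeasure ⊤
  have hμ : μ Set.univ = 1 := by
    have := Measure.haarMeasure_self (K₀ := (⊤ : TopologicalSpace.PositiveCompacts H))
    simpa using this
  have : IsProbabilityMeasure μ := ⟨hμ⟩
  -- the operators induced on `V`
  let R : H → V →L[ℝ] V := fun M => fstL α ∘L M.1.val ∘L inlL α
  have hRinl : ∀ M v, M.1.val (inlL α v) = inlL α (R M v) := fun M v => by
    ext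
    · rfl
    · rw [hsnd M.1 M.2]; rfl
  have hRmul : ∀ M N v, R (M * N) v = R M (R N v) := fun M N v => by
    change fstL α (M.1.val (N.1.val (inlL α v))) = _
    rw [hRinl]
    rfl
  have hRone : ∀ v, R 1 v = v := fun v => rfl
  have hRα : ∀ M v, R M (α v) = α (R M v) := fun M v => hcomm M.1 M.2 v
  have hRinj : ∀ M v, v ≠ 0 → R M v ≠ 0 := fun M v hv h0 => hv (by
    rw [← hRone v, ← inv_mul_cancel M, hRmul, h0, map_zero])
  have hvalc : Continuous fun M : H => M.1.val := Units.continuous_val.comp continuous_subtype_val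
  have hRc : Continuous fun M : H => R M⁻¹ :=
    continuous_const.clm_comp ((hvalc.comp continuous_inv).clm_comp continuous_const)
  -- the invariant inner product
  let Q : H → V →L[ℝ] V →L[ℝ] ℝ := fun M => h₀.bilinearComp (R M⁻¹) (R M⁻¹)
  have hQc : Continuous Q :=
    ((ContinuousLinearMap.compL ℝ V V ℝ).flip.continuous.comp hRc).clm_comp
      (continuous_const.clm_comp hRc)
  let h : V →L[ℝ] V →L[ℝ] ℝ := ∫ M, Q M ∂μ
  have happ : ∀ x y, h x y = ∫ M, h₀ (R M⁻¹ x) (R M⁻¹ y) ∂μ := fun x y => by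
    have h1 : h x = ∫ M, Q M x ∂μ := ContinuousLinearMap.integral_apply
      (hQc.integrable_of_hasCompactSupport (HasCompactSupport.of_compactSpace _)) x
    rw [h1, ContinuousLinearMap.integral_apply
      ((hQc.clm_apply continuous_const).integrable_of_hasCompactSupport
        (HasCompactSupport.of_compactSpace _))]
    rfl
  have hcont : ∀ x y, Continuous fun M => h₀ (R M⁻¹ x) (R M⁻¹ y) := fun x y =>
    (hQc.clm_apply continuous_const).clm_apply continuous_const
  have hinti : ∀ x y, Integrable (fun M => h₀ (R M⁻¹ x) (R M⁻¹ y)) μ := fun x y =>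
    (hcont x y).integrable_of_hasCompactSupport (HasCompactSupport.of_compactSpace _)
  have hpos0 : ∀ x, 0 ≤ h₀ x x := fun x => by
    rcases eq_or_ne x 0 with rfl | hx
    · simp
    · exact (hh.pos x hx).le
  -- the invariant vector
  let ζ : SemidirectLine α := ∫ M : H, M.1.val (inrL α 1) ∂μ
  have hζint : Integrable (fun M : H => M.1.val (inrL α 1)) μ :=
    (hvalc.clm_apply continuous_const).integrable_of_hasCompactSupport
      (HasCompactSupport.of_compactSpace _)
  have hζ1 : sndL α ζ = 1 := by
    rw [← ContinuousLinearMap.integral_comp_comm _ hζint]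
    have : ∀ M : H, sndL α (M.1.val (inrL α 1)) = 1 := fun M => by rw [hsnd M.1 M.2]; rfl
    simp [this]
  have hζ : inlL α (fstL α ζ) + inrL α 1 = ζ := by
    rw [← hζ1]
    exact inlL_add_inrL ζ
  refine ⟨h, fstL α ζ, ⟨fun x y => ?_, fun x hx => ?_, fun x => ?_, fun x => ?_⟩,
    fun N hN => ⟨?_, ?_⟩⟩
  · rw [happ, happ]
    simp only [hh.symm]
  · rw [happ]
    refine (hcont x x).integral_pos_of_hasCompactSupport_nonneg_nonzero
      (HasCompactSupport.of_compactSpace _) (fun M => hpos0 _) (x := 1) ?_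
    exact (hh.pos _ (hRinj _ x hx)).ne'
  · rw [happ, happ, ← integral_sub (hinti _ _) (hinti _ _), ← integral_const_mul]
    refine (abs_integral_le_integral_abs).trans (integral_mono ?_ ?_ fun M => ?_)
    · exact ((hinti _ _).sub (hinti _ _)).abs
    · exact (hinti _ _).const_mul _
    · simp only [hRα]
      exact hh.first _
  · have hadd : Integrable (fun M => h₀ (R M⁻¹ (α x)) (R M⁻¹ (α x)) +
        h₀ (R M⁻¹ (α (α x))) (R M⁻¹ x)) μ := (hinti _ _).add (hinti _ _)
    rw [happ, happ, happ, ← integral_const_mul, ← integral_add (hinti _ _) (hinti _ _),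
      ← integral_sub hadd ((hinti _ _).const_mul _), ← integral_const_mul]
    refine (abs_integral_le_integral_abs).trans (integral_mono ?_ ?_ fun M => ?_)
    · exact (hadd.sub ((hinti _ _).const_mul _)).abs
    · exact (hinti _ _).const_mul _
    · simp only [hRα]
      exact hh.second _
  · intro x y
    let N' : H := ⟨N, hN⟩
    change h (R N' x) (R N' y) = h x y
    rw [happ, happ]
    conv_rhs => rw [← integral_mul_left_eq_self _ N'⁻¹]
    refine integral_congr_ae (.of_forall fun M => ?_)
    simp only [mul_inv_rev, inv_inv, hRmul]
  · rw [hζ]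
    let N' : H := ⟨N, hN⟩
    change N.val (∫ M : H, M.1.val (inrL α 1) ∂μ) = ∫ M : H, M.1.val (inrL α 1) ∂μ
    rw [← ContinuousLinearMap.integral_comp_comm _ hζint,
      ← integral_mul_left_eq_self (fun M : H => M.1.val (inrL α 1)) N']
    rfl

variable [CompleteSpace V]

/-- If `V = 0`, then a compact group of automorphisms acts on the line by `1` and `-1`. -/
theorem exists_eq_smul_of_subsingleton [Subsingleton V]
    {K : Subgroup (MulAut (SemidirectLine α))} (hK : IsCompactAutGroup K)
    {φ : MulAut (SemidirectLine α)} (hφ : φ ∈ K) :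
    ∃ l : ℝ, l * l = 1 ∧ ∀ x, φ x = l • x := by
  have hsmul : ∀ ψ ∈ K, ∀ x, ψ x = sndL α (ψ (inrL α 1)) • x := by
    intro ψ hψ x
    let T₀ : ℝ →+ ℝ := AddMonoidHom.mk' (fun t => sndL α (ψ (inrL α t))) fun s t => by
      have e : inrL α (s + t) = inrL α s * inrL α t := by ext <;> simp
      rw [e, map_mul, sndL_mul]
    have hT₀ : Continuous T₀ := (sndL α).continuous.comp ((hK.1 ψ hψ).comp (inrL α).continuous)
    have h1 := map_smul (T₀.toRealLinearMap hT₀) (sndL α x) 1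
    rw [smul_eq_mul, mul_one] at h1
    have h2 : x = inrL α (sndL α x) := by
      ext
      · exact Subsingleton.elim _ _
      · rfl
    ext
    · exact Subsingleton.elim _ _
    · conv_lhs => rw [h2]
      rw [map_smul, smul_eq_mul, mul_comm]
      exact h1
  obtain ⟨C, hC⟩ := (hK.2.image (f := fun f : C(SemidirectLine α, SemidirectLine α) =>
    sndL α (f (inrL α 1))) ((sndL α).continuous.comp
      (continuous_eval_const _))).isBounded.exists_norm_le
  have hle : ∀ ψ ∈ K, |sndL α (ψ (inrL α 1))| ≤ 1 := by
    intro ψ hψ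
    by_contra! hlt
    have hpow : ∀ n : ℕ, sndL α ((ψ ^ n) (inrL α 1)) = sndL α (ψ (inrL α 1)) ^ n := by
      intro n
      induction n with
      | zero => simp
      | succ n ih =>
        rw [pow_succ', MulAut.mul_apply, hsmul ψ hψ, map_smul, ih, smul_eq_mul, pow_succ']
    obtain ⟨n, hn⟩ := pow_unbounded_of_one_lt C hlt
    have := hC _ ⟨⟨(ψ ^ n : MulAut (SemidirectLine α)), hK.1 _ (K.pow_mem hψ n)⟩,
      ⟨ψ ^ n, K.pow_mem hψ n, fun _ => rfl⟩, rfl⟩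
    simp only [ContinuousMap.coe_mk, hpow, norm_pow, Real.norm_eq_abs] at this
    exact absurd this (not_le.2 hn)
  refine ⟨sndL α (φ (inrL α 1)), ?_, hsmul φ hφ⟩
  have h1 := hle φ hφ
  have h2 := hle φ⁻¹ (K.inv_mem hφ)
  have h3 : sndL α (φ⁻¹ (inrL α 1)) * sndL α (φ (inrL α 1)) = 1 := by
    rw [← smul_eq_mul, ← map_smul, ← hsmul _ (K.inv_mem hφ), MulAut.inv_apply_self]
    simp
  set l := sndL α (φ (inrL α 1))
  set l' := sndL α (φ⁻¹ (inrL α 1))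
  have h4 : |l'| * |l| = 1 := by rw [← abs_mul, h3, abs_one]
  have h5 : |l| = 1 := by
    refine le_antisymm h1 ?_
    nlinarith [abs_nonneg l]
  rw [← abs_mul_abs_self, h5, mul_one]

variable [FiniteDimensional ℝ V]

/-- The derivatives at the identity of the automorphisms in a compact group form a compact group,
since they depend continuously on the automorphism. -/
theorem exists_isCompact_subgroup_fderiv [Nontrivial V]
    (hα : spectrum ℂ (LinearMap.baseChange ℂ α.toLinearMap : Module.End ℂ (ℂ ⊗[ℝ] V)) ⊆
      {z : ℂ | z.re = 1}) {K : Subgroup (MulAut (SemidirectLine α))} (hK : IsCompactAutGroup K) :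
    ∃ H : Subgroup (SemidirectLine α →L[ℝ] SemidirectLine α)ˣ,
      IsCompact (H : Set (SemidirectLine α →L[ℝ] SemidirectLine α)ˣ) ∧
      (∀ M ∈ H, ∃ φ ∈ K, M.val = fderiv ℝ φ 0) ∧ ∀ φ ∈ K, ∃ M ∈ H, M.val = fderiv ℝ φ 0 := by
  have hφ : ∀ φ : K, ∃ (A : V →L[ℝ] V) (w : V), (∀ v, A (α v) = α (A v)) ∧
      ∀ x, φ.1 x = affineAut A w x := fun φ => exists_eq_affineAut hα φ.1 (hK.1 φ.1 φ.2)
  have hd : ∀ φ : K, DifferentiableAt ℝ φ.1 0 := fun φ => by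
    obtain ⟨A, w, -, e⟩ := hφ φ
    rw [funext e]
    exact (hasFDerivAt_affineAut A w 0).differentiableAt
  have h0 : ∀ φ : K, φ.1 (0 : SemidirectLine α) = 0 := fun φ => map_one φ.1
  let ρ : K →* (SemidirectLine α →L[ℝ] SemidirectLine α) :=
    { toFun := fun φ => fderiv ℝ φ.1 0
      map_one' := by
        change fderiv ℝ id 0 = 1
        rw [fderiv_id]
        rfl
      map_mul' := fun φ ψ => by
        change fderiv ℝ (φ.1 ∘ ψ.1) 0 = _
        rw [fderiv_comp 0 (by rw [h0 ψ]; exact hd φ) (hd ψ), h0 ψ]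
        rfl }
  have hmem : ∀ M ∈ ρ.toHomUnits.range, ∃ φ ∈ K, M.val = fderiv ℝ φ 0 := by
    rintro M ⟨φ, rfl⟩
    exact ⟨φ.1, φ.2, rfl⟩
  refine ⟨ρ.toHomUnits.range, ?_, hmem, fun φ hφK => ⟨ρ.toHomUnits ⟨φ, hφK⟩, ⟨_, rfl⟩, rfl⟩⟩
  obtain ⟨h, hh⟩ := exists_isAdaptedInner α hα (ε := 1 / 2) (by norm_num)
  have hinj := flow_one_injective (by norm_num) hh
  let e : V ≃L[ℝ] V := (LinearEquiv.ofInjectiveEndo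
    (flow α 1 - (1 : V →L[ℝ] V)).toLinearMap hinj).toContinuousLinearEquiv
  have he : ∀ w, e.symm (flow α 1 w - w) = w := fun w => e.symm_apply_apply w
  let b := Module.finBasis ℝ V
  -- the derivative, recovered from finitely many values of the automorphism
  let Θ : C(SemidirectLine α, SemidirectLine α) → (SemidirectLine α →L[ℝ] SemidirectLine α) :=
    fun f => ∑ i, ((b.coord i).toContinuousLinearMap ∘L fstL α).smulRight (f (inlL α (b i))) +
      (sndL α).smulRight (inlL α (α (e.symm (fstL α (f (inrL α 1))))) + inrL α 1)
  have hΘc : Continuous Θ := by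
    have hsr : ∀ (l : SemidirectLine α →L[ℝ] ℝ), Continuous fun u : SemidirectLine α =>
        l.smulRight u := fun l => (ContinuousLinearMap.smulRightL ℝ _ _ l).continuous
    refine (continuous_finsetSum _ fun i _ =>
      (hsr _).comp (continuous_eval_const _)).add ((hsr _).comp ?_)
    exact ((inlL α).continuous.comp (α.continuous.comp (e.symm.continuous.comp
      ((fstL α).continuous.comp (continuous_eval_const _))))).add continuous_const
  have hΘ : ∀ φ ∈ K, ∀ f : C(SemidirectLine α, SemidirectLine α), (∀ x, f x = φ x) →
      Θ f = fderiv ℝ φ 0 := by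
    intro φ hφK f hf
    obtain ⟨A, w, hA, hφe⟩ := hφ ⟨φ, hφK⟩
    have hfe : ∀ x, f x = affineAut A w x := fun x => (hf x).trans (hφe x)
    have hφe' : (φ : SemidirectLine α → SemidirectLine α) = affineAut A w := funext hφe
    rw [hφe', (hasFDerivAt_affineAut A w 0).fderiv]
    have hsum : ∀ v, ∑ i, b.repr v i • A (b i) = A v := fun v => by
      conv_rhs => rw [← b.sum_repr v, map_sum]
      simp
    ext u
    · simp [Θ, hfe, affineAut, flow_zero, he, hsum]
    · simp [Θ, hfe, affineAut]
  rw [(Units.isOpenEmbedding_val).isInducing.isCompact_iff]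
  have himage : Units.val '' (ρ.toHomUnits.range : Set (SemidirectLine α →L[ℝ] SemidirectLine α)ˣ) =
      Θ '' {f | ∃ φ ∈ K, ∀ x, f x = φ x} := ?_
  · rw [himage]
    exact hK.2.image hΘc
  refine Set.ext fun L => ?_
  constructor
  · rintro ⟨M, hM, rfl⟩
    obtain ⟨φ, hφK, e1⟩ := hmem M hM
    exact ⟨⟨φ, hK.1 φ hφK⟩, ⟨φ, hφK, fun _ => rfl⟩, (hΘ φ hφK _ fun _ => rfl).trans e1.symm⟩
  · rintro ⟨f, ⟨φ, hφK, hf⟩, rfl⟩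
    exact ⟨ρ.toHomUnits ⟨φ, hφK⟩, ⟨_, rfl⟩, (hΘ φ hφK f hf).symm⟩

/-- The pinched metric for a compact group of automorphisms; the trivial group gives the existence
of pinched left-invariant metrics. -/
theorem exists_isPinched_metric_isInvariantUnder
    (hα : spectrum ℂ (LinearMap.baseChange ℂ α.toLinearMap : Module.End ℂ (ℂ ⊗[ℝ] V)) ⊆
      {z : ℂ | z.re = 1}) {K : Subgroup (MulAut (SemidirectLine α))} (hK : IsCompactAutGroup K)
    {b : ℝ} (hb : 1 < b) :
    ∃ g : SmoothMetric (SemidirectLine α), IsLeftInvariantMetric g ∧ g.IsPinched b ∧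
      ∀ φ ∈ K, g.IsInvariantUnder φ := by
  -- the solution of `1 + 4 ε = b² (1 - 4 ε)`
  obtain ⟨ε, hε0, hε1, hεb⟩ : ∃ ε : ℝ, 0 < ε ∧ 4 * ε < 1 ∧ 1 + 4 * ε ≤ b ^ 2 * (1 - 4 * ε) := by
    have hb2 : 0 < b ^ 2 - 1 := by nlinarith
    refine ⟨(b ^ 2 - 1) / (4 * (b ^ 2 + 1)), by positivity, ?_, le_of_eq ?_⟩
    · rw [mul_div_assoc', div_lt_one (by positivity)]
      linarith
    · field_simp
      ring
  have hc : 0 < 1 - 4 * ε := by linarith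
  obtain ⟨h₀, hh₀⟩ := exists_isAdaptedInner α hα hε0
  rcases subsingleton_or_nontrivial V with hV | hV
  · refine ⟨metric h₀ hh₀.symm hh₀.pos 0 hc, isLeftInvariantMetric_metric _ _ _ hc,
      isPinched_metric hh₀ hε0.le (by linarith) 0 hc le_rfl hεb, fun φ hφ => ?_⟩
    obtain ⟨l, hl, hφl⟩ := exists_eq_smul_of_subsingleton hK hφ
    have e : (φ : SemidirectLine α → SemidirectLine α) =
        (l • ContinuousLinearMap.id ℝ (SemidirectLine α) : _ →L[ℝ] _) := funext hφl
    rw [e]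
    refine ⟨ContinuousLinearMap.contDiff _, fun x u v => ?_⟩
    rw [ContinuousLinearMap.fderiv, form_metric_apply, form_metric_apply]
    have h0 : ∀ x y : V, h₀ x y = 0 := fun x y => by
      rw [Subsingleton.elim x 0, map_zero]; rfl
    simp only [h0, smul_apply, ContinuousLinearMap.id_apply, map_smul, smul_eq_mul]
    linear_combination (1 - 4 * ε) * sndL α u * sndL α v * hl
  · obtain ⟨H, hHc, hH, hHK⟩ := exists_isCompact_subgroup_fderiv hα hK
    have hφ : ∀ φ ∈ K, ∃ (A : V →L[ℝ] V) (w : V), (∀ v, A (α v) = α (A v)) ∧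
        (φ : SemidirectLine α → SemidirectLine α) = affineAut A w ∧ fderiv ℝ φ 0 =
          inlL α ∘L (A ∘L fstL α + (sndL α).smulRight (α w)) + inrL α ∘L sndL α := by
      intro φ hφ
      obtain ⟨A, w, hA, e⟩ := exists_eq_affineAut hα φ (hK.1 φ hφ)
      refine ⟨A, w, hA, funext e, ?_⟩
      rw [funext e, (hasFDerivAt_affineAut A w 0).fderiv, map_zero, flow_zero]
      rfl
    obtain ⟨h, ξ, hh, hinv⟩ := exists_invariant_isAdaptedInner hh₀ H hHc
      (fun M hM u => by
        obtain ⟨φ, hφK, e⟩ := hH M hM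
        obtain ⟨A, w, -, -, e'⟩ := hφ φ hφK
        simp [e, e'])
      (fun M hM v => by
        obtain ⟨φ, hφK, e⟩ := hH M hM
        obtain ⟨A, w, hA, -, e'⟩ := hφ φ hφK
        simp [e, e', hA])
    refine ⟨metric h hh.symm hh.pos ξ hc, isLeftInvariantMetric_metric _ _ _ hc,
      isPinched_metric hh hε0.le (by linarith) ξ hc le_rfl hεb, fun φ hφK => ?_⟩
    obtain ⟨A, w, hA, e, e'⟩ := hφ φ hφK
    obtain ⟨M, hMH, hM⟩ := hHK φ hφK
    obtain ⟨i1, i2⟩ := hinv M hMH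
    rw [hM, e'] at i1 i2
    rw [e]
    refine isInvariantUnder_affineAut hh.symm hh.pos hc hA (fun x y => ?_) ?_
    · simpa using i1 x y
    · simpa using congrArg (fstL α) i2

end SemidirectLine

end

theorem mainTheorem10 (m : ℕ)
    (α : EuclideanSpace ℝ (Fin m) →L[ℝ] EuclideanSpace ℝ (Fin m))
    (hα : spectrum ℂ (LinearMap.baseChange ℂ α.toLinearMap :
      Module.End ℂ (ℂ ⊗[ℝ] EuclideanSpace ℝ (Fin m))) ⊆ {z : ℂ | z.re = 1}) :
    (∀ b : ℝ, 1 < b →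
      ∃ g : SmoothMetric (SemidirectLine α), IsLeftInvariantMetric g ∧ g.IsPinched b) ∧
    (∀ K : Subgroup (MulAut (SemidirectLine α)), IsCompactAutGroup K →
      ∀ b : ℝ, 1 < b →
        ∃ g : SmoothMetric (SemidirectLine α), IsLeftInvariantMetric g ∧ g.IsPinched b ∧
          ∀ φ ∈ K, g.IsInvariantUnder φ) := by
  refine ⟨fun b hb => ?_, fun K hK b hb =>
    SemidirectLine.exists_isPinched_metric_isInvariantUnder hα hK hb⟩
  have hK : IsCompactAutGroup (⊥ : Subgroup (MulAut (SemidirectLine α))) := by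
    refine ⟨fun φ hφ => ?_, ?_⟩
    · rw [Subgroup.mem_bot.1 hφ]
      exact continuous_id
    · convert isCompact_singleton (x := ContinuousMap.id (SemidirectLine α)) using 1
      ext f
      constructor
      · rintro ⟨φ, hφ, hf⟩
        rw [Subgroup.mem_bot.1 hφ] at hf
        exact ContinuousMap.ext hf
      · rintro rfl
        exact ⟨1, Subgroup.mem_bot.2 rfl, fun _ => rfl⟩
  obtain ⟨g, h1, h2, -⟩ :=
    SemidirectLine.exists_isPinched_metric_isInvariantUnder hα hK hb
  exact ⟨g, h1, h2⟩
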